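/- **Setting.** A (finite) cost probabilistic automaton consists of a finite state set $S$ with a start state, a set $\Sigma$ of actions divided into internal actions $H$ and external actions $E$, a finite set $D$ of transitions $tr=(v,b,\rho)$ with $v\in S$, $b\in\Sigma$ and $\rho$ a probability distribution on $S$, and a cost function $c\colon D\to\mathbb{R}_{\ge 0}$. A finite execution fragment is a sequence $\alpha=s_0a_1s_1\dots a_ns_n$ such that for each $i$ there is $(s_{i-1},a_i,\rho)\in D$ with $\rho(s_i)>0$; its trace is its sequence of external actions, and $\mathrm{trace}(a)$ is $a$ for $a\in E$ and empty for $a\in H$. A scheduler $\sigma$ assigns to each finite execution fragment $\alpha$ a sub-probability distribution $\sigma(\alpha)$ on the transitions leaving the last state of $\alpha$; the missing mass $\sigma(\alpha)(\bot)$ is the probability of stopping. For a state $t$ put $P_{\sigma,t}(C_{s})=1$ if $s=t$, $P_{\sigma,t}(C_{s})=0$ for states $s\ne t$, $P_{\sigma,t}(C_{\alpha b v})=P_{\sigma,t}(C_\alpha)\sum_{tr=(\cdot,b,\rho)\in D}\sigma(\alpha)(tr)\,\rho(v)$, and $P_{\sigma,t}(\alpha)=P_{\sigma,t}(C_\alpha)\,\sigma(\alpha)(\bot)$.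 The scheduler $\sigma$ induces the weak combined transition $t\Rightarrow^{a}\mu_t$ if $\sum_\alpha P_{\sigma,t}(\alpha)=1$, every $\alpha$ with $P_{\sigma,t}(\alpha)>0$ has trace $\mathrm{trace}(a)$, and $\sum_{\alpha \text{ ending in } u}P_{\sigma,t}(\alpha)=\mu_t(u)$ for all $u\in S$. Its cost is $c_\sigma(t\Rightarrow^a\mu_t)=\sum_\alpha c_\sigma(\alpha)P_{\sigma,t}(\alpha)\in[0,\infty]$, where $c_\sigma(s)=0$ for a single state $s$ and $$c_\sigma(\alpha b v)=c_\sigma(\alpha)+\frac{\sum_{tr=(\cdot,b,\rho)\in D} c(tr)\,\sigma(\alpha)(tr)\,\rho(v)}{\sum_{tr=(\cdot,b,\rho)\in D}\sigma(\alpha)(tr)\,\rho(v)}$$ (the quotient being $0$ if its denominator is $0$). For $R\subseteq S\times S$, $\mu\,\mathcal{L}(R)\,\nu$ means that there is $w\colon S\times S\to[0,1]$ with marginals $\mu$ and $\nu$ such that $w(x,y)>0$ implies $x\,R\,y$. **The min-cost LP** for $t\in S$, $a\in\Sigma$, a probability distribution $\mu$ on $S$ and $R\subseteq S\times S$. Let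 $a\in E$. The network has a source $\vartriangle$, a sink $\blacktriangledown$, vertices $v$, $v_a$, $v_R$ for $v\in S$, and vertices $v^{tr}$, $v^{tr}_a$ for $tr=(v,b,\rho)\in D$ with $b\in H\cup\{a\}$. Its arcs are: $(\vartriangle,t)$; $(v_a,u_R)$ and $(u_R,\blacktriangledown)$ whenever $u\,R\,v$; for each internal $tr=(v,b,\rho)\in D$ (i.e. $b\in H$) and each $v'$ with $\rho(v')>0$, the arcs $(v,v^{tr})$, $(v^{tr},v')$, $(v_a,v^{tr}_a)$, $(v^{tr}_a,v'_a)$; and for each $tr=(v,a,\rho)\in D$ and each $v'$ with $\rho(v')>0$, the arcs $(v,v_a^{tr})$, $(v_a^{tr},v_a')$. There is one variable $f_{x,y}\ge 0$ per arc (read $f_{x,y}=0$ on non-arcs), with the constraints $f_{\vartriangle,t}=1$; $f_{v_R,\blacktriangledown}=\mu(v)$ for $v\in S$; inflow equals outflow at each vertex other than $\vartriangle,\blacktriangledown$; and, for each $v'$ with $\rho(v')>0$, $f_{v^{tr},v'}=\rho(v')f_{v,v^{tr}}$ and $f_{v^{tr}_a,v'_a}=\rho(v')f_{v_a,v^{tr}_a}$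 for internal $tr=(v,b,\rho)\in D$, and $f_{v^{tr}_a,v'_a}=\rho(v')f_{v,v^{tr}_a}$ for $tr=(v,a,\rho)\in D$. The objective, to be minimised, is the sum of $c(tr)\,f_{x,y}$ over the arcs $(v,v^{tr})$, $(v_a,v_a^{tr})$, $(v,v_a^{tr})$. If $a\in H$, the vertices $v_a$, $v_a^{tr}$ and their arcs and constraints are dropped, and the arcs $(v_a,u_R)$ are replaced by $(v,u_R)$ (for $u\,R\,v$). **Statement.** Let a cost probabilistic automaton, $R\subseteq S\times S$, $a\in\Sigma$, a probability distribution $\mu$ on $S$ and $t\in S$ be given, and suppose that there is a weak combined transition $t\Rightarrow^a\mu_t$ with $\mu\,\mathcal{L}(R)\,\mu_t$. Then the min-cost LP has an optimal solution, and its optimal value $\mathfrak{C}$ satisfies $$\mathfrak{C}=\min\{\,c_\sigma(t\Rightarrow^a\mu_t) : \sigma \text{ induces } t\Rightarrow^a\mu_t \text{ for some } \mu_t \text{ with } \mu\,\mathcal{L}(R)\,\mu_t\,\};$$ in particular the minimum is attained. -/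

import Mathlib

open scoped ENNReal NNReal BigOperators

namespace CostPA

/-- A finite probabilistic automaton with state space `S` and action set `Act`: a start state, the
set `hidden` of internal actions (all other actions are external), and a finite set `D` of
transitions `(s, a, ρ)` with `ρ` a probability distribution on `S`. -/
structure PA (S Act : Type*) where
  start : S
  hidden : Set Act
  D : Finset (S × Act × PMF S)

/-- A cost probabilistic automaton: a probabilistic automaton with a total cost function
`D → ℝ≥0` on its transitions. -/
structure CPA (S Act : Type*) extends PA S Act where
  cost : {x : S × Act × PMF S // x ∈ D} → ℝ≥0

section Automata

variable {S Act : Type*}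

/-- The type of transitions of an automaton. -/
abbrev PA.Tr (A : PA S Act) : Type _ := {x : S × Act × PMF S // x ∈ A.D}

/-- Source state of a transition. -/
def PA.Tr.src {A : PA S Act} (tr : A.Tr) : S := tr.1.1

/-- Label of a transition. -/
def PA.Tr.act {A : PA S Act} (tr : A.Tr) : Act := tr.1.2.1

/-- Target distribution of a transition. -/
def PA.Tr.dist {A : PA S Act} (tr : A.Tr) : PMF S := tr.1.2.2

/-- `FinFrag A u` is the type of finite execution fragments `s₀ a₁ s₁ … aₙ sₙ` of `A` whose last
state is `u = sₙ`; for each step there is a transition `(sᵢ₋₁, aᵢ, ρ)` with `ρ sᵢ > 0`. -/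
inductive FinFrag (A : PA S Act) : S → Type _
  | nil (s : S) : FinFrag A s
  | snoc {u : S} (α : FinFrag A u) (a : Act) (v : S)
      (h : ∃ tr : A.Tr, tr.src = u ∧ tr.act = a ∧ 0 < tr.dist v) : FinFrag A v

/-- The type of all finite execution fragments. -/
abbrev FinFrags (A : PA S Act) : Type _ := Σ u : S, FinFrag A u

open scoped Classical in
/-- The trace of a single action: itself if external, empty if internal. -/
noncomputable def traceAct (A : PA S Act) (a : Act) : List Act :=
  if a ∈ A.hidden then [] else [a]

/-- The trace of a finite execution fragment: its sequence of external actions. -/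
noncomputable def FinFrag.trace {A : PA S Act} : {u : S} → FinFrag A u → List Act
  | _, .nil _ => []
  | _, .snoc α a _ _ => α.trace ++ traceAct A a

/-- A scheduler assigns to every finite execution fragment a sub-probability distribution over the
transitions that leave its last state. -/
structure Scheduler (A : PA S Act) where
  prob : {u : S} → FinFrag A u → A.Tr → ℝ≥0∞
  sum_le_one : ∀ {u : S} (α : FinFrag A u), ∑ tr : A.Tr, prob α tr ≤ 1
  src_eq : ∀ {u : S} (α : FinFrag A u) (tr : A.Tr), prob α tr ≠ 0 → tr.src = u

namespace Scheduler

variable {A : PA S Act} (σ : Scheduler A)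

/-- Probability `σ(α)(⊥)` of stopping after `α`. -/
noncomputable def halt {u : S} (α : FinFrag A u) : ℝ≥0∞ := 1 - ∑ tr : A.Tr, σ.prob α tr

open scoped Classical in
/-- One-step probability of extending `α` by action `a` and state `v`:
the sum of `σ(α)(tr) * ρ_tr(v)` over the transitions `tr` labelled `a`. -/
noncomputable def step {u : S} (α : FinFrag A u) (a : Act) (v : S) : ℝ≥0∞ :=
  ∑ tr : A.Tr with tr.act = a, σ.prob α tr * tr.dist v

open scoped Classical in
/-- Probability of the cone of a finite execution fragment, when `σ` is started in `s`. -/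
noncomputable def coneProb (s : S) : {u : S} → FinFrag A u → ℝ≥0∞
  | _, .nil u => if u = s then 1 else 0
  | _, .snoc α a v _ => coneProb s α * σ.step α a v

/-- Probability of performing exactly the finite execution fragment `α` and then stopping. -/
noncomputable def fragProb (s : S) {u : S} (α : FinFrag A u) : ℝ≥0∞ :=
  σ.coneProb s α * σ.halt α

/-- `σ` induces the weak combined transition from `s` to `μ` labelled by `a`. -/
structure Induces (s : S) (a : Act) (μ : PMF S) : Prop where
  terminates : ∑' α : FinFrags A, σ.fragProb s α.2 = 1
  trace_eq : ∀ {u : S} (α : FinFrag A u), 0 < σ.fragProb s α → α.trace = traceAct A a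
  target : ∀ u : S, ∑' α : FinFrag A u, σ.fragProb s α = μ u

open scoped Classical in
/-- The normalised contribution of the transition `tr` to the step `α a v`. -/
noncomputable def hat {u : S} (α : FinFrag A u) (v : S) (a : Act) (tr : A.Tr) : ℝ≥0∞ :=
  if 0 < σ.step α a v then σ.prob α tr * tr.dist v / σ.step α a v else 0

end Scheduler

open scoped Classical in
/-- The cost of a single finite execution fragment under the scheduler `σ`. -/
noncomputable def CPA.fragCost (A : CPA S Act) (σ : Scheduler A.toPA) :
    {u : S} → FinFrag A.toPA u → ℝ≥0∞
  | _, .nil _ => 0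
  | _, .snoc α a v _ =>
      A.fragCost σ α + ∑ tr : A.toPA.Tr with tr.act = a, (A.cost tr : ℝ≥0∞) * σ.hat α v a tr

/-- The cost, under the scheduler `σ` started in `s`, of the weak combined transition induced by
`σ`: the expected cost of the execution fragment after which `σ` stops. It may be infinite. -/
noncomputable def CPA.weakCost (A : CPA S Act) (σ : Scheduler A.toPA) (s : S) : ℝ≥0∞ :=
  ∑' α : FinFrags A.toPA, A.fragCost σ α.2 * σ.fragProb s α.2

/-- The lifting of a relation to probability distributions, by means of a weighting function. -/
def Lift {X Y : Type*} (R : X → Y → Prop) (μ : PMF X) (ν : PMF Y) : Prop :=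
  ∃ w : X → Y → ℝ≥0∞,
    (∀ x y, w x y ≤ 1) ∧
    (∀ x y, 0 < w x y → R x y) ∧
    (∀ x, ∑' y, w x y = μ x) ∧
    (∀ y, ∑' x, w x y = ν y)

/-- There is a weak combined transition from `s` to `μ` labelled by `a`. -/
def WeakTransition (A : PA S Act) (s : S) (a : Act) (μ : PMF S) : Prop :=
  ∃ σ : Scheduler A, σ.Induces s a μ

/-- The costs `c_σ` of the weak combined transitions from `t` labelled by `a` to some `μt` with
`μ L(R) μt`, as induced by the various schedulers `σ`. -/
def CPA.costs (A : CPA S Act) (R : S → S → Prop) (t : S) (a : Act) (μ : PMF S) : Set ℝ≥0∞ :=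
  {k | ∃ (σ : Scheduler A.toPA) (μt : PMF S),
    σ.Induces t a μt ∧ Lift R μ μt ∧ A.weakCost σ t = k}

/-! The network and the linear program -/

/-- The vertices of the network: source, sink, the states `v`, the transition vertices `v^tr`, their
copies `v_a` and `v_a^tr` (after the external action `a`), and the vertices `s_R`.
Vertices that do not belong to the network of a given action carry no arc, see `Arc`. -/
inductive Vertex (A : PA S Act) : Type _
  | source : Vertex A
  | sink : Vertex A
  | state (v : S) : Vertex A
  | trans (tr : A.Tr) : Vertex A
  | stateA (v : S) : Vertex A
  | transA (tr : A.Tr) : Vertex A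
  | rel (s : S) : Vertex A

/-- The vertices as a disjoint union. -/
def Vertex.equivSum (A : PA S Act) :
    Vertex A ≃ (Bool ⊕ S) ⊕ (A.Tr ⊕ S) ⊕ (A.Tr ⊕ S) where
  toFun
    | .source => .inl (.inl true)
    | .sink => .inl (.inl false)
    | .rel s => .inl (.inr s)
    | .trans tr => .inr (.inl (.inl tr))
    | .state v => .inr (.inl (.inr v))
    | .transA tr => .inr (.inr (.inl tr))
    | .stateA v => .inr (.inr (.inr v))
  invFun
    | .inl (.inl true) => .source
    | .inl (.inl false) => .sink
    | .inl (.inr s) => .rel s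
    | .inr (.inl (.inl tr)) => .trans tr
    | .inr (.inl (.inr v)) => .state v
    | .inr (.inr (.inl tr)) => .transA tr
    | .inr (.inr (.inr v)) => .stateA v
  left_inv x := by cases x <;> rfl
  right_inv x := by
    rcases x with ((_ | _) | _) | (_ | _) | (_ | _) <;> rfl

instance Vertex.instFintype [Fintype S] (A : PA S Act) : Fintype (Vertex A) :=
  Fintype.ofEquiv _ (Vertex.equivSum A).symm

/-- The arcs of the network for the initial state `t`, the action `a` and the relation `R`.
For an internal action `a` the layer of copies is absent and states are linked to the vertices
`u_R` directly. The flow that arrives in state `v` may be sent to `u_R` when `u R v`. -/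
inductive Arc (A : PA S Act) (R : S → S → Prop) (t : S) (a : Act) : Vertex A → Vertex A → Prop
  | source : Arc A R t a .source (.state t)
  | relHidden (ha : a ∈ A.hidden) (u v : S) (h : R u v) : Arc A R t a (.state v) (.rel u)
  | relExternal (ha : a ∉ A.hidden) (u v : S) (h : R u v) : Arc A R t a (.stateA v) (.rel u)
  | sink (u v : S) (h : R u v) : Arc A R t a (.rel u) .sink
  | tauIn (tr : A.Tr) (h : tr.act ∈ A.hidden) : Arc A R t a (.state tr.src) (.trans tr)
  | tauOut (tr : A.Tr) (h : tr.act ∈ A.hidden) (v : S) (hv : 0 < tr.dist v) :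
      Arc A R t a (.trans tr) (.state v)
  | tauInA (ha : a ∉ A.hidden) (tr : A.Tr) (h : tr.act ∈ A.hidden) :
      Arc A R t a (.stateA tr.src) (.transA tr)
  | tauOutA (ha : a ∉ A.hidden) (tr : A.Tr) (h : tr.act ∈ A.hidden) (v : S)
      (hv : 0 < tr.dist v) : Arc A R t a (.transA tr) (.stateA v)
  | actIn (ha : a ∉ A.hidden) (tr : A.Tr) (h : tr.act = a) :
      Arc A R t a (.state tr.src) (.transA tr)
  | actOut (ha : a ∉ A.hidden) (tr : A.Tr) (h : tr.act = a) (v : S) (hv : 0 < tr.dist v) :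
      Arc A R t a (.transA tr) (.stateA v)

open scoped Classical in
/-- Feasible solutions of the linear program. There is one variable per arc; a solution is
represented by a function on all pairs of vertices that vanishes outside the arcs. -/
structure Feasible [Fintype S] (A : PA S Act) (R : S → S → Prop) (t : S) (a : Act) (μ : PMF S)
    (f : Vertex A → Vertex A → ℝ) : Prop where
  off_arc : ∀ x y, ¬ Arc A R t a x y → f x y = 0
  nonneg : ∀ x y, Arc A R t a x y → 0 ≤ f x y
  source : f .source (.state t) = 1
  sink : ∀ v : S, f (.rel v) .sink = (μ v).toReal
  conservation : ∀ x : Vertex A, x ≠ .source → x ≠ .sink →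
    (∑ u : Vertex A with Arc A R t a u x, f u x)
      - (∑ y : Vertex A with Arc A R t a x y, f x y) = 0
  balance_tau : ∀ tr : A.Tr, tr.act ∈ A.hidden → ∀ v : S, 0 < tr.dist v →
    f (.trans tr) (.state v) - (tr.dist v).toReal * f (.state tr.src) (.trans tr) = 0
  balance_tauA : a ∉ A.hidden → ∀ tr : A.Tr, tr.act ∈ A.hidden → ∀ v : S, 0 < tr.dist v →
    f (.transA tr) (.stateA v) - (tr.dist v).toReal * f (.stateA tr.src) (.transA tr) = 0
  balance_act : a ∉ A.hidden → ∀ tr : A.Tr, tr.act = a → ∀ v : S, 0 < tr.dist v →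
    f (.transA tr) (.stateA v) - (tr.dist v).toReal * f (.state tr.src) (.transA tr) = 0

/-- The cost coefficient of an arc: the cost of `tr` on arcs that enter a vertex of the
transition `tr`, and zero on all other arcs. -/
def CPA.arcCost (A : CPA S Act) : Vertex A.toPA → Vertex A.toPA → ℝ
  | .state _, .trans tr => A.cost tr
  | .stateA _, .transA tr => A.cost tr
  | .state _, .transA tr => A.cost tr
  | _, _ => 0

open scoped Classical in
/-- The objective function of the min-cost linear program. -/
noncomputable def CPA.objective [Fintype S] (A : CPA S Act) (R : S → S → Prop) (t : S) (a : Act)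
    (f : Vertex A.toPA → Vertex A.toPA → ℝ) : ℝ :=
  ∑ e : Vertex A.toPA × Vertex A.toPA with Arc A.toPA R t a e.1 e.2,
    A.arcCost e.1 e.2 * f e.1 e.2

/-- The objective values of the feasible solutions of the min-cost linear program. -/
def CPA.lpValues [Fintype S] (A : CPA S Act) (R : S → S → Prop) (t : S) (a : Act) (μ : PMF S) :
    Set ℝ :=
  {r | ∃ f : Vertex A.toPA → Vertex A.toPA → ℝ,
    Feasible A.toPA R t a μ f ∧ A.objective R t a f = r}

end Automata

end CostPA

/-! Flows and schedulers are matched by counting. Split executions into layers according to how much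
of the trace of `a` has been produced, and let `g m tr` be the expected number of times that `tr` is
taken from layer `m`. Flow conservation at a state of a layer says that arrivals equal departures
plus stops, and the objective is the expected sum of transition costs. The network LP is therefore
rewritten in the variables `g` and the weighting `w` of the lifting (`LayerFlow`,
`mem_lpValues_iff`).

From flow to scheduler (`LayerFlow.exists_scheduler`): choose transitions in proportion to the flow.
Expected visits are at most the flow, hence finite, so the scheduler stops almost surely; its
stopping distribution is dominated by that of the flow, and both have mass one, so they agree. The
inequality for visits may be strict, since a flow may circulate on cycles that are never reached;
the scheduler then costs at most as much as the flow.

From scheduler to flow (`Scheduler.Induces.exists_layerFlow`): expected counts can be infinite even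
when the cost is finite, so they are not a flow in general. Counts truncated at `n` steps are finite
and satisfy the balance equations up to an error that tends to zero, with costs bounded by the cost
of the scheduler. The counts themselves need not converge, but a finitely generated cone is closed
(`isClosed_image_orthant_face`), so the limiting equations, cost included, have an exact nonnegative
solution.

The same closedness gives an optimal solution of the LP. The two directions then force the optimum
and the minimal scheduler cost to coincide. The cost of an almost surely terminating scheduler is
compared with its summed step costs in `CPA.weakCost_le` and `CPA.le_weakCost`. -/

open Filter Topology

namespace CostPA

/-! ### Closedness of finitely generated cones -/

section ClosedCone

variable {ι E : Type*} [Fintype ι] [NormedAddCommGroup E] [NormedSpace ℝ E]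

/-- The image, under a linear map, of a face of the nonnegative orthant is closed. -/
theorem isClosed_image_orthant_face (M : (ι → ℝ) →ₗ[ℝ] E) (s : Finset ι) :
    IsClosed (M '' {z | 0 ≤ z ∧ ∀ i ∉ s, z i = 0}) := by
  classical
  induction s using Finset.strongInduction with
  | H s ih =>
  let V : Submodule ℝ (ι → ℝ) :=
    { carrier := {z | ∀ i ∉ s, z i = 0}
      add_mem' := fun {x y} hx hy i hi => by simp [hx i hi, hy i hi]
      zero_mem' := fun i _ => rfl
      smul_mem' := fun c x hx i hi => by simp [hx i hi] }
  -- If `M` is injective on the span of the face, it is a closed embedding there. Otherwise a kernel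
  -- vector allows a Carathéodory reduction to finitely many smaller faces.
  by_cases hker : LinearMap.ker (M.domRestrict V) = ⊥
  · have hemb := LinearMap.isClosedEmbedding_of_injective hker
    have hcl : IsClosed {z : V | 0 ≤ (z : ι → ℝ)} :=
      isClosed_Ici.preimage continuous_subtype_val
    have := hemb.isClosedMap _ hcl
    convert this using 1
    ext y
    constructor
    · rintro ⟨z, ⟨hz, hzs⟩, rfl⟩
      exact ⟨⟨z, hzs⟩, hz, rfl⟩
    · rintro ⟨z, hz, rfl⟩
      exact ⟨z, ⟨hz, z.2⟩, rfl⟩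
  · obtain ⟨k, hks, hMk, i₀, hi₀⟩ : ∃ k : ι → ℝ, (∀ i ∉ s, k i = 0) ∧ M k = 0 ∧ ∃ i, 0 < k i := by
      obtain ⟨k, hk, hk0⟩ := (Submodule.ne_bot_iff _).1 hker
      have hMk : M k = 0 := hk
      have hk0' : (k : ι → ℝ) ≠ 0 := fun h => hk0 (Subtype.ext h)
      obtain ⟨i, hi⟩ := Function.ne_iff.1 hk0'
      rcases lt_or_gt_of_ne hi with h | h
      · refine ⟨-k, fun j hj => ?_, by simp [hMk], i, by simpa using h⟩
        simpa using k.2 j hj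
      · exact ⟨k, k.2, hMk, i, h⟩
    have hunion : M '' {z | 0 ≤ z ∧ ∀ i ∉ s, z i = 0}
        = ⋃ j ∈ s, M '' {z | 0 ≤ z ∧ ∀ i ∉ s.erase j, z i = 0} := by
      apply Set.Subset.antisymm
      · rintro _ ⟨z, ⟨hz, hzs⟩, rfl⟩
        -- The smallest ratio is the largest multiple of `k` that can be subtracted without leaving
        -- the orthant; it makes coordinate `j` vanish and does not change the image under `M`.
        obtain ⟨j, hj, hmin⟩ := Finset.exists_min_image (Finset.univ.filter fun i => 0 < k i)
          (fun i => z i / k i) ⟨i₀, by simpa using hi₀⟩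
        have hkj : 0 < k j := (Finset.mem_filter.1 hj).2
        have hjs : j ∈ s := by
          by_contra h
          exact hkj.ne' (hks j h)
        refine Set.mem_biUnion hjs ⟨z - (z j / k j) • k, ⟨fun i => ?_, fun i hi => ?_⟩, ?_⟩
        · have hq : 0 ≤ z j / k j := div_nonneg (hz j) hkj.le
          rcases le_or_gt (k i) 0 with h | h
          · have := mul_nonneg_of_nonpos_of_nonpos (neg_nonpos.2 hq) h
            have := hz i
            simp only [Pi.zero_apply, Pi.sub_apply, Pi.smul_apply, smul_eq_mul] at *
            linarith
          · have := hmin i (by simpa using h)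
            rw [le_div_iff₀ h] at this
            simpa using this
        · by_cases hij : i = j
          · subst hij
            simp [div_mul_cancel₀ _ hkj.ne']
          · have : i ∉ s := fun h => hi (Finset.mem_erase.2 ⟨hij, h⟩)
            simp [hks i this, hzs i this]
        · simp [hMk]
      · refine Set.iUnion₂_subset fun j hj => ?_
        rintro _ ⟨z, ⟨hz, hzs⟩, rfl⟩
        exact ⟨z, ⟨hz, fun i hi => hzs i fun h => hi (Finset.mem_of_mem_erase h)⟩, rfl⟩
    rw [hunion]
    exact s.finite_toSet.isClosed_biUnion fun j hj => ih _ (Finset.erase_ssubset hj)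

/-- A system of linear equations that has approximate nonnegative solutions has a nonnegative
solution. -/
theorem exists_nonneg_eq_of_tendsto {κ : Type*} [Fintype κ] (ℓ : κ → (ι → ℝ) →ₗ[ℝ] ℝ) (y : κ → ℝ)
    (z : ℕ → ι → ℝ) (hz : ∀ n i, 0 ≤ z n i)
    (hlim : ∀ j, Tendsto (fun n => ℓ j (z n)) atTop (𝓝 (y j))) :
    ∃ x : ι → ℝ, (∀ i, 0 ≤ x i) ∧ ∀ j, ℓ j x = y j := by
  have hcl := isClosed_image_orthant_face (LinearMap.pi ℓ) Finset.univ
  obtain ⟨x, ⟨hx, -⟩, hxy⟩ := hcl.mem_of_tendsto (tendsto_pi_nhds.2 hlim)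
    (Eventually.of_forall fun n => ⟨z n, ⟨hz n, by simp⟩, rfl⟩)
  exact ⟨x, hx, fun j => congrFun hxy j⟩

end ClosedCone

/-! ### The network LP in condensed form -/

section LayerFlow

variable {S Act : Type*}

/-- A transition that may be taken in a layer: in layer `false` the action `a` has not been
performed yet, in layer `true` it has. -/
def Admissible (A : PA S Act) (a : Act) (m : Bool) (tr : A.Tr) : Prop :=
  (m = true → a ∉ A.hidden) ∧ (tr.act ∈ A.hidden ∨ m = false ∧ tr.act = a)

open scoped Classical in
/-- The layer reached from layer `m` by an admissible transition. -/
noncomputable def nextLayer (A : PA S Act) (m : Bool) (tr : A.Tr) : Bool :=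
  m || decide (tr.act ∉ A.hidden)

/-- The layer in which executions may stop. -/
def IsFinal (A : PA S Act) (a : Act) (m : Bool) : Prop := m = true ↔ a ∉ A.hidden

open scoped Classical in
/-- The linear program in condensed form: `g m tr` is the flow through the transition `tr` in layer
`m`, and `w u v` the flow from the state `v` of the final layer to the vertex `u_R`. -/
structure LayerFlow [Fintype S] (A : PA S Act) (R : S → S → Prop) (t : S) (a : Act) (μ : PMF S)
    (g : Bool → A.Tr → ℝ) (w : S → S → ℝ) : Prop where
  g_nonneg : ∀ m tr, 0 ≤ g m tr
  w_nonneg : ∀ u v, 0 ≤ w u v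
  g_zero : ∀ m tr, ¬ Admissible A a m tr → g m tr = 0
  w_zero : ∀ u v, ¬ R u v → w u v = 0
  balance : ∀ m v, (if m = false ∧ v = t then 1 else 0)
      + ∑ m' : Bool, ∑ tr : A.Tr, (if nextLayer A m' tr = m then g m' tr * (tr.dist v).toReal else 0)
      = (∑ tr : A.Tr, if tr.src = v then g m tr else 0)
        + if IsFinal A a m then ∑ u, w u v else 0
  sink : ∀ u, ∑ v, w u v = (μ u).toReal

/-- The cost of a flow in condensed form. -/
noncomputable def CPA.layerCost (A : CPA S Act) (g : Bool → A.toPA.Tr → ℝ) : ℝ :=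
  ∑ m : Bool, ∑ tr : A.toPA.Tr, (A.cost tr : ℝ) * g m tr

theorem sum_vertex [Fintype S] {A : PA S Act} {N : Type*} [AddCommMonoid N] (F : Vertex A → N) :
    ∑ x, F x = F .source + F .sink + ∑ v, F (.rel v)
      + (∑ tr, F (.trans tr) + ∑ v, F (.state v))
      + (∑ tr, F (.transA tr) + ∑ v, F (.stateA v)) := by
  rw [← Equiv.sum_comp (Vertex.equivSum A).symm]
  simp only [Fintype.sum_sum_type, Vertex.equivSum, Equiv.coe_fn_symm_mk, Fintype.sum_bool]
  abel

/-- Lets `simp` decide arcs by the shape of their endpoints. -/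
theorem arc_iff {A : PA S Act} {R : S → S → Prop} {t : S} {a : Act} (x y : Vertex A) :
    Arc A R t a x y ↔ match x, y with
      | .source, .state v => v = t
      | .state v, .rel u => a ∈ A.hidden ∧ R u v
      | .stateA v, .rel u => a ∉ A.hidden ∧ R u v
      | .rel u, .sink => ∃ v, R u v
      | .state v, .trans tr => tr.act ∈ A.hidden ∧ v = tr.src
      | .trans tr, .state v => tr.act ∈ A.hidden ∧ 0 < tr.dist v
      | .stateA v, .transA tr => a ∉ A.hidden ∧ tr.act ∈ A.hidden ∧ v = tr.src
      | .transA tr, .stateA v => a ∉ A.hidden ∧ (tr.act ∈ A.hidden ∨ tr.act = a) ∧ 0 < tr.dist v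
      | .state v, .transA tr => a ∉ A.hidden ∧ tr.act = a ∧ v = tr.src
      | _, _ => False := by
  constructor
  · intro h
    cases h <;> simp_all
    exact ⟨_, ‹_›⟩
  · intro h
    cases x <;> cases y <;> simp only at h
    · exact h ▸ .source
    · exact h.2 ▸ .tauIn _ h.1
    · exact h.2.2 ▸ .actIn h.1 _ h.2.1
    · exact .relHidden h.1 _ _ h.2
    · exact .tauOut _ h.1 _ h.2
    · exact h.2.2 ▸ .tauInA h.1 _ h.2.1
    · exact .relExternal h.1 _ _ h.2
    · obtain ⟨h1, h2 | h2, h3⟩ := h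
      · exact .tauOutA h1 _ h2 _ h3
      · exact .actOut h1 _ h2 _ h3
    · obtain ⟨v, h⟩ := h
      exact .sink _ v h

variable [Fintype S]

open scoped Classical in
theorem Feasible.conservation_univ {A : PA S Act} {R : S → S → Prop} {t : S} {a : Act} {μ : PMF S}
    {f : Vertex A → Vertex A → ℝ} (hf : Feasible A R t a μ f) (x : Vertex A)
    (h1 : x ≠ .source) (h2 : x ≠ .sink) : ∑ u, f u x = ∑ y, f x y := by
  have := hf.conservation x h1 h2
  rw [Finset.sum_filter_of_ne, Finset.sum_filter_of_ne] at this
  · linarith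
  · intro y _ hy
    by_contra h
    exact hy (hf.off_arc _ _ h)
  · intro y _ hy
    by_contra h
    exact hy (hf.off_arc _ _ h)

theorem objective_eq (A : CPA S Act) {R : S → S → Prop} {t : S} {a : Act}
    {f : Vertex A.toPA → Vertex A.toPA → ℝ} (hf : ∀ x y, ¬ Arc A.toPA R t a x y → f x y = 0) :
    A.objective R t a f = ∑ tr : A.toPA.Tr, (A.cost tr : ℝ) *
      (f (.state tr.src) (.trans tr) + f (.state tr.src) (.transA tr)
        + f (.stateA tr.src) (.transA tr)) := by
  classical
  unfold CPA.objective
  rw [Finset.sum_filter_of_ne, Fintype.sum_prod_type]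
  · simp only [sum_vertex, CPA.arcCost, zero_mul, Finset.sum_const_zero, add_zero, zero_add]
    have h1 : ∀ tr : A.toPA.Tr, ∑ v, f (.state v) (.trans tr) = f (.state tr.src) (.trans tr) :=
      fun tr => Fintype.sum_eq_single _ fun v hv => hf _ _ (by simp [arc_iff, hv])
    have h2 : ∀ tr : A.toPA.Tr, ∑ v, f (.state v) (.transA tr) = f (.state tr.src) (.transA tr) :=
      fun tr => Fintype.sum_eq_single _ fun v hv => hf _ _ (by simp [arc_iff, hv])
    have h3 : ∀ tr : A.toPA.Tr, ∑ v, f (.stateA v) (.transA tr) = f (.stateA tr.src) (.transA tr) :=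
      fun tr => Fintype.sum_eq_single _ fun v hv => hf _ _ (by simp [arc_iff, hv])
    simp only [Finset.sum_add_distrib, mul_add]
    rw [Finset.sum_comm (γ := S), Finset.sum_comm (γ := S), Finset.sum_comm (γ := S)]
    simp only [← Finset.mul_sum, h1, h2, h3]
  · intro e _ he
    by_contra h
    exact he (by rw [hf _ _ h, mul_zero])

/-- The balance constraints determine the flow out of a transition vertex from the flow into it, so
only the latter is kept. What remains of conservation concerns the states, which gives `balance`,
and the vertices `u_R`, which gives `sink`. -/
theorem Feasible.exists_layerFlow {A : CPA S Act} {R : S → S → Prop} {t : S} {a : Act} {μ : PMF S}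
    {f : Vertex A.toPA → Vertex A.toPA → ℝ} (hf : Feasible A.toPA R t a μ f) :
    ∃ g w, LayerFlow A.toPA R t a μ g w ∧ A.layerCost g = A.objective R t a f := by
  classical
  have hz := hf.off_arc
  have hn : ∀ x y, 0 ≤ f x y := fun x y => by
    by_cases h : Arc A.toPA R t a x y
    · exact hf.nonneg _ _ h
    · exact (hz _ _ h).ge
  have hz' : ∀ x y, ¬ (Arc A.toPA R t a x y) → f x y = 0 := hz
  simp only [arc_iff] at hz'
  -- At most one summand for `false` is nonzero: the first arc needs an internal label, the second
  -- the external label `a`. The same holds for `w`, where the layer of the arc depends on whether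
  -- `a` is internal.
  let g : Bool → A.toPA.Tr → ℝ := fun m tr => bif m then f (.stateA tr.src) (.transA tr) else
    f (.state tr.src) (.trans tr) + f (.state tr.src) (.transA tr)
  let w : S → S → ℝ := fun u v => f (.state v) (.rel u) + f (.stateA v) (.rel u)
  have hout : ∀ (tr : A.toPA.Tr) (v : S), f (.trans tr) (.state v)
      = if tr.act ∈ A.hidden then g false tr * (tr.dist v).toReal else 0 := by
    intro tr v
    split_ifs with h
    · have h1 : f (.state tr.src) (.transA tr) = 0 := by
        apply hz'
        rintro ⟨h1, h2, -⟩
        exact h1 (h2 ▸ h)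
      by_cases hv : 0 < tr.dist v
      · have := hf.balance_tau tr h v hv
        simp only [g, cond_false, h1]
        linarith
      · have h2 : tr.dist v = 0 := by simpa using hv
        rw [hz' _ _ (by simp [h2]), h2]
        simp
    · exact hz' _ _ (by simp [h])
  have houtA : ∀ (tr : A.toPA.Tr) (v : S), f (.transA tr) (.stateA v)
      = (if tr.act ∈ A.hidden then 0 else g false tr * (tr.dist v).toReal)
        + g true tr * (tr.dist v).toReal := by
    intro tr v
    by_cases ha : a ∈ A.hidden
    · rw [hz' _ _ (by simp [ha])]
      simp only [g, cond_true, cond_false]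
      rw [hz' (.stateA _) (.transA _) (by simp [ha]), hz' (.state _) (.transA _) (by simp [ha])]
      split_ifs with h
      · simp
      · rw [hz' (.state _) (.trans _) (by simp [h])]
        simp
    by_cases hv : 0 < tr.dist v
    · by_cases h : tr.act ∈ A.hidden
      · have := hf.balance_tauA ha tr h v hv
        simp only [g, cond_true, h, if_true]
        linarith
      · have h1 : f (.stateA tr.src) (.transA tr) = 0 := hz' _ _ (by simp [h])
        have h2 : f (.state tr.src) (.trans tr) = 0 := hz' _ _ (by simp [h])
        by_cases h3 : tr.act = a
        · have := hf.balance_act ha tr h3 v hv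
          simp only [g, cond_true, cond_false, h, if_false, h1, h2]
          linarith
        · have h4 : f (.state tr.src) (.transA tr) = 0 := hz' _ _ (by simp [h3])
          simp only [g, cond_true, cond_false, h, if_false, h1, h2, h4]
          rw [hz' _ _ (by simp [h, h3])]
          simp
    · have h2 : tr.dist v = 0 := by simpa using hv
      rw [hz' _ _ (by simp [h2]), h2]
      simp
  refine ⟨g, w, ⟨?_, ?_, ?_, ?_, ?_, ?_⟩, ?_⟩
  · rintro (_ | _) tr
    · exact add_nonneg (hn _ _) (hn _ _)
    · exact hn _ _
  · exact fun u v => add_nonneg (hn _ _) (hn _ _)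
  · rintro (_ | _) tr h
    · simp only [Admissible, true_and, Bool.false_eq_true, false_imp_iff, not_or] at h
      simp only [g, cond_false]
      rw [hz' _ _ (by simp [h.1]), hz' _ _ (by simp [h.2]), add_zero]
    · apply hz'
      rintro ⟨h1, h2, -⟩
      exact h ⟨fun _ => h1, Or.inl h2⟩
  · intro u v h
    simp only [w]
    rw [hz' _ _ (by simp [h]), hz' _ _ (by simp [h]), add_zero]
  · rintro (_ | _) v
    · have h0 : f .source (.state v) = if v = t then 1 else 0 := by
        split_ifs with h
        · rw [h, hf.source]
        · exact hz' _ _ (by simp [h])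
      have h1 : ∀ tr : A.toPA.Tr, f (.state v) (.trans tr) + f (.state v) (.transA tr)
          = if tr.src = v then g false tr else 0 := by
        intro tr
        split_ifs with h
        · subst h
          rfl
        · rw [hz' _ _ (by simp [Ne.symm h]), hz' _ _ (by simp [Ne.symm h]), add_zero]
      have h2 : (if a ∈ A.hidden then ∑ u, w u v else 0) = ∑ u, f (.state v) (.rel u) := by
        split_ifs with h
        · exact Finset.sum_congr rfl fun u _ => by
            simp only [w]
            rw [hz' (.stateA v) _ (by simp [h]), add_zero]
        · exact (Finset.sum_eq_zero fun u _ => hz' _ _ (by simp [h])).symm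
      have := hf.conservation_univ (.state v) (by simp) (by simp)
      simp [sum_vertex, hz', h0, hout, -Finset.univ_eq_attach] at this
      simp [nextLayer, IsFinal, h2, -Finset.univ_eq_attach]
      rw [this, add_assoc, ← Finset.sum_add_distrib, add_comm]
      simp only [h1]
    · have h1 : ∀ tr : A.toPA.Tr, f (.stateA v) (.transA tr)
          = if tr.src = v then g true tr else 0 := by
        intro tr
        split_ifs with h
        · subst h
          rfl
        · rw [hz' _ _ (by simp [Ne.symm h])]
      have h2 : (if a ∈ A.hidden then 0 else ∑ u, w u v) = ∑ u, f (.stateA v) (.rel u) := by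
        split_ifs with h
        · exact (Finset.sum_eq_zero fun u _ => hz' _ _ (by simp [h])).symm
        · exact Finset.sum_congr rfl fun u _ => by
            simp only [w]
            rw [hz' (.state v) _ (by simp [h]), zero_add]
      have := hf.conservation_univ (.stateA v) (by simp) (by simp)
      simp [sum_vertex, hz', h1, houtA, Finset.sum_add_distrib, -Finset.univ_eq_attach] at this
      simp [nextLayer, IsFinal, h2, -Finset.univ_eq_attach]
      linarith
  · intro u
    have := hf.conservation_univ (.rel u) (by simp) (by simp)
    simp [sum_vertex, hz', hf.sink] at this
    rw [← this, ← Finset.sum_add_distrib]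
  · rw [objective_eq A hf.off_arc, CPA.layerCost, Fintype.sum_bool, ← Finset.sum_add_distrib]
    refine Finset.sum_congr rfl fun tr _ => ?_
    simp only [g, cond_true, cond_false]
    ring

open scoped Classical in
/-- The flow in the network that corresponds to a flow in condensed form. -/
noncomputable def networkFlow (A : PA S Act) (t : S) (a : Act) (μ : PMF S)
    (g : Bool → A.Tr → ℝ) (w : S → S → ℝ) : Vertex A → Vertex A → ℝ
  | .source, .state v => if v = t then 1 else 0
  | .state v, .rel u => if a ∈ A.hidden then w u v else 0
  | .stateA v, .rel u => if a ∈ A.hidden then 0 else w u v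
  | .rel u, .sink => (μ u).toReal
  | .state v, .trans tr => if tr.act ∈ A.hidden ∧ tr.src = v then g false tr else 0
  | .trans tr, .state v => if tr.act ∈ A.hidden then (tr.dist v).toReal * g false tr else 0
  | .stateA v, .transA tr => if tr.src = v then g true tr else 0
  | .transA tr, .stateA v =>
      (tr.dist v).toReal * (if tr.act ∈ A.hidden then g true tr else g false tr)
  | .state v, .transA tr => if tr.act ∉ A.hidden ∧ tr.src = v then g false tr else 0
  | _, _ => 0

theorem LayerFlow.exists_feasible {A : CPA S Act} {R : S → S → Prop} {t : S} {a : Act} {μ : PMF S}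
    {g : Bool → A.toPA.Tr → ℝ} {w : S → S → ℝ} (hg : LayerFlow A.toPA R t a μ g w) :
    ∃ f, Feasible A.toPA R t a μ f ∧ A.objective R t a f = A.layerCost g := by
  classical
  have hadm : ∀ m tr, g m tr ≠ 0 → Admissible A.toPA a m tr := fun m tr h =>
    not_not.1 fun h' => h (hg.g_zero m tr h')
  have hR : ∀ u v, w u v ≠ 0 → R u v := fun u v h => not_not.1 fun h' => h (hg.w_zero u v h')
  have htrue : ∀ tr : A.toPA.Tr, g true tr ≠ 0 → a ∉ A.hidden ∧ tr.act ∈ A.hidden := fun tr h =>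
    ⟨(hadm _ _ h).1 rfl, by simpa using (hadm _ _ h).2⟩
  have hfalse : ∀ tr : A.toPA.Tr, g false tr ≠ 0 → tr.act ∈ A.hidden ∨ tr.act = a := fun tr h =>
    by simpa using (hadm _ _ h).2
  let f := networkFlow A.toPA t a μ g w
  -- `networkFlow` tests only part of the arc conditions; the others follow from the vanishing of
  -- `g` on inadmissible transitions, of `w` outside `R`, and of products with zero probability.
  have hoff : ∀ x y, f x y ≠ 0 → Arc A.toPA R t a x y := by
    intro x y h
    rw [arc_iff]
    cases x <;> cases y <;> simp only [f, networkFlow, ne_eq, not_true_eq_false] at h ⊢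
    · exact (ite_ne_right_iff.1 h).1
    · obtain ⟨⟨h1, h2⟩, -⟩ := ite_ne_right_iff.1 h
      exact ⟨h1, h2.symm⟩
    · obtain ⟨⟨h1, h2⟩, h3⟩ := ite_ne_right_iff.1 h
      have h4 := (hfalse _ h3).resolve_left h1
      exact ⟨h4 ▸ h1, h4, h2.symm⟩
    · obtain ⟨h1, h2⟩ := ite_ne_right_iff.1 h
      exact ⟨h1, hR _ _ h2⟩
    · obtain ⟨h1, h2⟩ := ite_ne_right_iff.1 h
      exact ⟨h1, (ENNReal.toReal_pos_iff.1 (lt_of_le_of_ne ENNReal.toReal_nonneg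
        (left_ne_zero_of_mul h2).symm)).1⟩
    · obtain ⟨h1, h2⟩ := ite_ne_right_iff.1 h
      exact ⟨(htrue _ h2).1, (htrue _ h2).2, h1.symm⟩
    · obtain ⟨h1, h2⟩ := ite_ne_left_iff.1 h
      exact ⟨h1, hR _ _ (Ne.symm h2)⟩
    · have h1 := (ENNReal.toReal_pos_iff.1 (lt_of_le_of_ne ENNReal.toReal_nonneg
        (left_ne_zero_of_mul h).symm)).1
      have h2 := right_ne_zero_of_mul h
      split_ifs at h2 with h3
      · exact ⟨(htrue _ h2).1, Or.inl h3, h1⟩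
      · have h4 := (hfalse _ h2).resolve_left h3
        exact ⟨h4 ▸ h3, Or.inr h4, h1⟩
    · rw [← hg.sink] at h
      obtain ⟨v, -, hv⟩ := Finset.exists_ne_zero_of_sum_ne_zero h
      exact ⟨v, hR _ _ hv⟩
  have hdist : ∀ tr : A.toPA.Tr, ∑ v, (tr.dist v).toReal = 1 := fun tr => by
    rw [← ENNReal.toReal_sum fun v _ => PMF.apply_ne_top _ _, ← tsum_fintype (L := .unconditional S), PMF.tsum_coe,
      ENNReal.toReal_one]
  have hnn : ∀ x y, 0 ≤ f x y := by
    intro x y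
    have h1 := hg.g_nonneg
    have h2 := hg.w_nonneg
    cases x <;> cases y <;> simp only [f, networkFlow, le_refl] <;> try split_ifs
    all_goals first
      | positivity | exact h1 _ _ | exact h2 _ _
      | exact mul_nonneg ENNReal.toReal_nonneg (h1 _ _)
  have hoff' : ∀ x y, ¬ Arc A.toPA R t a x y → f x y = 0 := fun x y h =>
    not_not.1 fun h' => h (hoff x y h')
  have hcons : ∀ x : Vertex A.toPA, x ≠ .source → x ≠ .sink → ∑ u, f u x = ∑ y, f x y := by
    intro x h1 h2
    cases x
    · exact absurd rfl h1
    · exact absurd rfl h2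
    · rename_i v
      have := hg.balance false v
      simp [nextLayer, IsFinal, -Finset.univ_eq_attach] at this
      simp [sum_vertex, f, networkFlow, -Finset.univ_eq_attach]
      rw [add_comm, add_assoc, ← Finset.sum_add_distrib]
      simp only [mul_comm (g false _)] at this
      rw [add_comm, this, add_comm]
      congr 1
      refine Finset.sum_congr rfl fun tr _ => ?_
      by_cases h : tr.act ∈ A.hidden <;> simp [h]
    · rename_i tr
      simp [sum_vertex, f, networkFlow, -Finset.univ_eq_attach]
      split_ifs with h
      · simp [h, ← Finset.sum_mul, hdist]
      · simp [h]
    · rename_i v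
      have := hg.balance true v
      simp [nextLayer, IsFinal, -Finset.univ_eq_attach] at this
      simp [sum_vertex, f, networkFlow, -Finset.univ_eq_attach]
      rw [add_comm, ← this, ← Finset.sum_add_distrib]
      refine Finset.sum_congr rfl fun tr _ => ?_
      split_ifs with h
      · ring
      · rw [not_not.1 fun h' => h (htrue tr h').2]
        ring
    · rename_i tr
      simp [sum_vertex, f, networkFlow, -Finset.univ_eq_attach]
      split_ifs with h
      · simp [h, ← Finset.sum_mul, hdist]
      · simp [h, ← Finset.sum_mul, hdist, not_not.1 fun h' => h (htrue tr h').2]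
    · rename_i u
      simp [sum_vertex, f, networkFlow, -Finset.univ_eq_attach]
      rw [← hg.sink]
      split_ifs <;> simp
  refine ⟨f, ⟨hoff', fun x y _ => hnn x y, ?_, fun _ => rfl, ?_, ?_, ?_, ?_⟩, ?_⟩
  · simp [f, networkFlow]
  · intro x h1 h2
    rw [Finset.sum_filter_of_ne fun u _ h => hoff _ _ h,
      Finset.sum_filter_of_ne fun u _ h => hoff _ _ h, hcons x h1 h2, sub_self]
  · intro tr h v hv
    simp [f, networkFlow, h]
  · intro ha tr h v hv
    simp [f, networkFlow, h]
  · intro ha tr h v hv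
    simp [f, networkFlow, h, ha]
  · rw [objective_eq A hoff', CPA.layerCost, Fintype.sum_bool, ← Finset.sum_add_distrib]
    refine Finset.sum_congr rfl fun tr _ => ?_
    by_cases h : tr.act ∈ A.hidden <;> simp [f, networkFlow, h] <;> ring

end LayerFlow

/-! ### Expectations by execution length, layers and costs -/

section Levels

variable {S Act : Type*}

/-- The number of steps of an execution fragment. -/
def FinFrag.len {A : PA S Act} : {u : S} → FinFrag A u → ℕ
  | _, .nil _ => 0
  | _, .snoc α _ _ _ => α.len + 1

/-- The possible one-step extensions of an execution fragment. -/
abbrev FinFrags.Ext {A : PA S Act} (α : FinFrags A) : Type _ :=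
  {q : Act × S // ∃ tr : A.Tr, tr.src = α.1 ∧ tr.act = q.1 ∧ 0 < tr.dist q.2}

/-- Extension of an execution fragment by one step. -/
def FinFrags.extend {A : PA S Act} (α : FinFrags A) (q : α.Ext) : FinFrags A :=
  ⟨q.1.2, .snoc α.2 q.1.1 q.1.2 q.2⟩

theorem FinFrags.extend_injective {A : PA S Act} :
    Function.Injective fun p : Σ α : FinFrags A, α.Ext => p.1.extend p.2 := by
  rintro ⟨⟨u, α⟩, ⟨⟨b, v⟩, h⟩⟩ ⟨⟨u', α'⟩, ⟨⟨b', v'⟩, h'⟩⟩ heq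
  simp only [FinFrags.extend, Sigma.mk.injEq] at heq
  obtain ⟨rfl, heq⟩ := heq
  simp only [heq_eq_eq, FinFrag.snoc.injEq] at heq
  obtain ⟨rfl, hα, rfl⟩ := heq
  simp only [heq_eq_eq] at hα
  subst hα
  rfl

namespace Scheduler

variable {A : PA S Act} (σ : Scheduler A)

open scoped Classical in
/-- Expectation of `φ` over the execution fragments of length `n`. -/
noncomputable def level (s : S) (n : ℕ) (φ : FinFrags A → ℝ≥0∞) : ℝ≥0∞ :=
  ∑' α : FinFrags A, if α.2.len = n then σ.coneProb s α.2 * φ α else 0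

/-- Expected value of `φ` after one more step. -/
noncomputable def next (φ : FinFrags A → ℝ≥0∞) (α : FinFrags A) : ℝ≥0∞ :=
  ∑' q : α.Ext, σ.step α.2 q.1.1 q.1.2 * φ (α.extend q)

variable (s : S)

theorem tsum_level (φ : FinFrags A → ℝ≥0∞) :
    ∑' n, σ.level s n φ = ∑' α : FinFrags A, σ.coneProb s α.2 * φ α := by
  unfold level
  rw [ENNReal.tsum_comm]
  refine tsum_congr fun α => ?_
  rw [tsum_eq_single α.2.len fun n hn => if_neg (Ne.symm hn), if_pos rfl]

theorem level_zero (φ : FinFrags A → ℝ≥0∞) : σ.level s 0 φ = φ ⟨s, .nil s⟩ := by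
  unfold level
  rw [tsum_eq_single ⟨s, .nil s⟩]
  · simp [FinFrag.len, coneProb]
  · rintro ⟨u, α⟩ h
    cases α with
    | nil =>
      have : u ≠ s := fun h' => h (h' ▸ rfl)
      simp [coneProb, this]
    | snoc => simp [FinFrag.len]

/-- The tower property: a fragment of length `n + 1` is uniquely a fragment of length `n` with a
one-step extension. Every later recursion rests on it. -/
theorem level_succ (n : ℕ) (φ : FinFrags A → ℝ≥0∞) :
    σ.level s (n + 1) φ = σ.level s n (σ.next φ) := by
  unfold level
  rw [← FinFrags.extend_injective.tsum_eq, ENNReal.tsum_sigma']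
  · refine tsum_congr fun α => ?_
    simp only [FinFrags.extend, FinFrag.len, add_left_inj, coneProb, next]
    split_ifs
    · rw [← ENNReal.tsum_mul_left]
      exact tsum_congr fun q => by rw [mul_assoc]
    · simp
  · rintro ⟨u, α⟩ h
    cases α with
    | nil => simp [FinFrag.len] at h
    | snoc α b v hv => exact ⟨⟨⟨_, α⟩, ⟨(b, u), hv⟩⟩, rfl⟩

theorem level_congr (n : ℕ) {φ ψ : FinFrags A → ℝ≥0∞}
    (h : ∀ α, α.2.len = n → φ α = ψ α) : σ.level s n φ = σ.level s n ψ := by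
  unfold level
  refine tsum_congr fun α => ?_
  split_ifs with h'
  · rw [h α h']
  · rfl

theorem level_mono (n : ℕ) {φ ψ : FinFrags A → ℝ≥0∞} (h : ∀ α, φ α ≤ ψ α) :
    σ.level s n φ ≤ σ.level s n ψ := by
  unfold level
  refine ENNReal.tsum_le_tsum fun α => ?_
  split_ifs
  · gcongr
    exact h α
  · rfl

theorem level_add (n : ℕ) (φ ψ : FinFrags A → ℝ≥0∞) :
    σ.level s n (fun α => φ α + ψ α) = σ.level s n φ + σ.level s n ψ := by
  unfold level
  rw [← ENNReal.tsum_add]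
  refine tsum_congr fun α => ?_
  split_ifs
  · rw [mul_add]
  · simp

theorem level_const_mul (n : ℕ) (c : ℝ≥0∞) (φ : FinFrags A → ℝ≥0∞) :
    σ.level s n (fun α => c * φ α) = c * σ.level s n φ := by
  unfold level
  rw [← ENNReal.tsum_mul_left]
  refine tsum_congr fun α => ?_
  split_ifs
  · rw [mul_left_comm]
  · simp

theorem level_sum {ι : Type*} (n : ℕ) (T : Finset ι) (φ : ι → FinFrags A → ℝ≥0∞) :
    σ.level s n (fun α => ∑ i ∈ T, φ i α) = ∑ i ∈ T, σ.level s n (φ i) := by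
  classical
  induction T using Finset.induction with
  | empty => simp [level]
  | insert i T hi ih => simp only [Finset.sum_insert hi, level_add, ih]

theorem step_ne_top [Fintype S] {u : S} (α : FinFrag A u) (b : Act) (v : S) :
    σ.step α b v ≠ ⊤ := by
  classical
  refine ne_top_of_le_ne_top ENNReal.one_ne_top (le_trans ?_ (σ.sum_le_one α))
  refine (Finset.sum_le_sum_of_subset (Finset.subset_univ _)).trans
    (Finset.sum_le_sum fun tr _ => ?_)
  exact mul_le_of_le_one_right' (PMF.coe_le_one _ _)

/-- Sums over the one-step extensions of a fragment, arranged by transitions. -/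
theorem tsum_ext [Fintype S] (α : FinFrags A) (F : A.Tr → S → ℝ≥0∞) :
    open scoped Classical in
    ∑' q : α.Ext, ∑ tr : A.Tr with tr.act = q.1.1, σ.prob α.2 tr * tr.dist q.1.2 * F tr q.1.2
      = ∑ tr : A.Tr, σ.prob α.2 tr * ∑ v, tr.dist v * F tr v := by
  classical
  -- The sum may run over all pairs: a nonzero summand already supplies the transition that makes
  -- the pair an extension.
  have h := Subtype.val_injective.tsum_eq (f := fun q : Act × S =>
    ∑ tr : A.Tr with tr.act = q.1, σ.prob α.2 tr * tr.dist q.2 * F tr q.2)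
    (g := (Subtype.val : α.Ext → Act × S)) ?_
  · refine h.trans ?_
    rw [ENNReal.tsum_prod']
    simp only [Finset.sum_filter, tsum_fintype]
    simp only [Finset.sum_comm (s := (Finset.univ : Finset S))]
    rw [Summable.tsum_finsetSum fun _ _ => ENNReal.summable]
    refine Finset.sum_congr rfl fun tr _ => ?_
    rw [tsum_eq_single tr.act fun b hb => by simp [Ne.symm hb], Finset.mul_sum]
    simp [mul_assoc]
  · intro q hq
    obtain ⟨tr, htr, h⟩ := Finset.exists_ne_zero_of_sum_ne_zero hq
    have h1 := left_ne_zero_of_mul h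
    exact ⟨⟨q, tr, σ.src_eq _ _ (left_ne_zero_of_mul h1), (Finset.mem_filter.1 htr).2,
      pos_iff_ne_zero.2 (right_ne_zero_of_mul h1)⟩, rfl⟩

theorem next_one [Fintype S] (α : FinFrags A) :
    σ.next (fun _ => 1) α = ∑ tr : A.Tr, σ.prob α.2 tr := by
  have h := σ.tsum_ext α fun _ _ => 1
  simp only [mul_one] at h
  simp only [next, step, mul_one, h]
  refine Finset.sum_congr rfl fun tr _ => ?_
  rw [← tsum_fintype (L := .unconditional S), PMF.tsum_coe, mul_one]

theorem halt_add_sum_prob {u : S} (α : FinFrag A u) :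
    σ.halt α + ∑ tr : A.Tr, σ.prob α tr = 1 :=
  tsub_add_cancel_of_le (σ.sum_le_one α)

/-- Conservation of mass: an execution has stopped before step `n` or is still running. -/
theorem sum_level_halt_add_level_one [Fintype S] (n : ℕ) :
    ∑ j ∈ Finset.range n, σ.level s j (fun α => σ.halt α.2) + σ.level s n (fun _ => 1) = 1 := by
  induction n with
  | zero => simp [level_zero]
  | succ n ih =>
    rw [Finset.sum_range_succ, level_succ, add_assoc, ← level_add]
    simpa only [next_one, halt_add_sum_prob] using ih

theorem level_one_le [Fintype S] (n : ℕ) : σ.level s n (fun _ => 1) ≤ 1 :=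
  (σ.sum_level_halt_add_level_one s n).le.trans' le_add_self

theorem tendsto_level_one [Fintype S] (h : ∑' α : FinFrags A, σ.fragProb s α.2 = 1) :
    Tendsto (fun n => σ.level s n fun _ => 1) atTop (𝓝 0) := by
  have h1 : ∑' n, σ.level s n (fun α => σ.halt α.2) = 1 := by
    rw [tsum_level]
    exact h
  have h2 := (ENNReal.summable (f := fun n => σ.level s n fun α => σ.halt α.2)).hasSum.tendsto_sum_nat
  rw [h1] at h2
  have h3 : ∀ n, σ.level s n (fun _ => 1)
      = 1 - ∑ j ∈ Finset.range n, σ.level s j (fun α => σ.halt α.2) := fun n =>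
    ENNReal.eq_sub_of_add_eq' ENNReal.one_ne_top
      ((add_comm _ _).trans (σ.sum_level_halt_add_level_one s n))
  simp only [h3]
  simpa using ENNReal.Tendsto.sub (tendsto_const_nhds (x := (1 : ℝ≥0∞))) h2
    (Or.inl ENNReal.one_ne_top)

end Scheduler

open scoped Classical in
/-- The effect of an action on the layer; `none` stands for a trace from which the trace of `a`
cannot be completed any more. -/
noncomputable def stepLayer (A : PA S Act) (a : Act) (o : Option Bool) (b : Act) : Option Bool :=
  if b ∈ A.hidden then o else if o = some false ∧ b = a then some true else none

/-- The layer reached by an execution fragment. -/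
noncomputable def FinFrag.layer {A : PA S Act} (a : Act) : {u : S} → FinFrag A u → Option Bool
  | _, .nil _ => some false
  | _, .snoc α b _ _ => stepLayer A a (α.layer a) b

/-- The layer is the finite amount of information about the trace that is needed to recognise
`traceAct A a`. -/
theorem FinFrag.layer_spec {A : PA S Act} (a : Act) {u : S} (α : FinFrag A u) :
    (α.layer a = some false ↔ α.trace = []) ∧
    (α.layer a = some true ↔ a ∉ A.hidden ∧ α.trace = [a]) := by
  induction α with
  | nil => simp [layer, trace]
  | snoc α b v h ih =>
    by_cases hb : b ∈ A.hidden
    · simpa [layer, trace, stepLayer, traceAct, hb] using ih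
    · simp only [layer, trace, stepLayer, traceAct, hb, if_false]
      constructor
      · split_ifs <;> simp
      · split_ifs with h'
        · obtain ⟨h1, rfl⟩ := h'
          simp [ih.1.1 h1, hb]
        · simp only [false_iff, not_and]
          intro _ h1
          rw [List.append_eq_singleton_iff] at h1
          exact h' (by simpa [ih.1] using h1)

theorem FinFrag.trace_eq_iff {A : PA S Act} {a : Act} {u : S} (α : FinFrag A u) :
    α.trace = traceAct A a ↔ ∃ m, IsFinal A a m ∧ α.layer a = some m := by
  by_cases ha : a ∈ A.hidden
  · simp [traceAct, IsFinal, ha, (α.layer_spec a).1]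
  · simp [traceAct, IsFinal, ha, (α.layer_spec a).2]

theorem stepLayer_of_admissible {A : PA S Act} {a : Act} {m : Bool} {tr : A.Tr}
    (h : Admissible A a m tr) : stepLayer A a (some m) tr.act = some (nextLayer A m tr) := by
  by_cases htr : tr.act ∈ A.hidden
  · simp [stepLayer, nextLayer, htr]
  · have := h.2.resolve_left htr
    simp [stepLayer, nextLayer, this, this.2 ▸ htr]

theorem stepLayer_of_not_admissible {A : PA S Act} {a : Act} {m : Bool} {tr : A.Tr}
    (hm : m = true → a ∉ A.hidden) (h : ¬ Admissible A a m tr) :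
    stepLayer A a (some m) tr.act = none := by
  simp only [Admissible, not_and, not_or] at h
  have := h hm
  rw [stepLayer, if_neg this.1, if_neg]
  simpa using this.2

/-- One-step expectations of functions of layer and last state are reduced to transitions, because
the new layer depends on the extension only through its action. -/
theorem Scheduler.next_layer [Fintype S] {A : PA S Act} (σ : Scheduler A) (a : Act)
    (ψ : Option Bool → S → ℝ≥0∞) (α : FinFrags A) :
    σ.next (fun α => ψ (α.2.layer a) α.1) α
      = ∑ tr : A.Tr, σ.prob α.2 tr *
          ∑ v, tr.dist v * ψ (stepLayer A a (α.2.layer a) tr.act) v := by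
  classical
  rw [← σ.tsum_ext α fun tr v => ψ (stepLayer A a (α.2.layer a) tr.act) v, Scheduler.next]
  refine tsum_congr fun q => ?_
  rw [Scheduler.step, Finset.sum_mul]
  refine Finset.sum_congr rfl fun tr htr => ?_
  rw [(Finset.mem_filter.1 htr).2]
  rfl

open scoped Classical in
/-- The cost of an execution fragment when the `j`-th step counts with weight `d j`. -/
noncomputable def CPA.weightedCost (A : CPA S Act) (σ : Scheduler A.toPA) (d : ℕ → ℝ≥0∞) :
    {u : S} → FinFrag A.toPA u → ℝ≥0∞
  | _, .nil _ => 0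
  | _, .snoc α a v _ => A.weightedCost σ d α +
      d α.len * ∑ tr : A.toPA.Tr with tr.act = a, (A.cost tr : ℝ≥0∞) * σ.hat α v a tr

/-- Expected cost of the step that follows a fragment. -/
noncomputable def CPA.stepCost (A : CPA S Act) (σ : Scheduler A.toPA) (α : FinFrags A.toPA) :
    ℝ≥0∞ :=
  ∑ tr : A.toPA.Tr, A.cost tr * σ.prob α.2 tr

theorem CPA.weightedCost_one (A : CPA S Act) (σ : Scheduler A.toPA) {u : S}
    (α : FinFrag A.toPA u) : A.weightedCost σ (fun _ => 1) α = A.fragCost σ α := by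
  induction α with
  | nil => rfl
  | snoc α b v h ih => simp only [weightedCost, fragCost, ih, one_mul]

theorem CPA.weightedCost_mono (A : CPA S Act) (σ : Scheduler A.toPA) {d d' : ℕ → ℝ≥0∞}
    (h : ∀ n, d n ≤ d' n) {u : S} (α : FinFrag A.toPA u) :
    A.weightedCost σ d α ≤ A.weightedCost σ d' α := by
  induction α with
  | nil => rfl
  | snoc α b v _ ih =>
    simp only [weightedCost]
    gcongr
    exact h _

/-- Undoes the normalisation in the fragment cost. When the denominator is zero, every summand of
`step` is zero, so the convention for `hat` does no harm. -/
theorem Scheduler.step_mul_hat [Fintype S] {A : PA S Act} (σ : Scheduler A) {u : S}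
    (α : FinFrag A u) (v : S) (tr : A.Tr) :
    σ.step α tr.act v * σ.hat α v tr.act tr = σ.prob α tr * tr.dist v := by
  classical
  unfold Scheduler.hat
  split_ifs with h
  · exact ENNReal.mul_div_cancel h.ne' (σ.step_ne_top _ _ _)
  · have h0 : σ.step α tr.act v = 0 := by simpa using h
    rw [mul_zero]
    have := (Finset.sum_eq_zero_iff.1 (show ∑ tr' : A.Tr with tr'.act = tr.act,
      σ.prob α tr' * tr'.dist v = 0 from h0)) tr (by simp)
    exact this.symm

theorem CPA.next_weightedCost [Fintype S] (A : CPA S Act) (σ : Scheduler A.toPA) (d : ℕ → ℝ≥0∞)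
    (α : FinFrags A.toPA) :
    σ.next (fun α => A.weightedCost σ d α.2) α
      = A.weightedCost σ d α.2 * ∑ tr, σ.prob α.2 tr + d α.2.len * A.stepCost σ α := by
  classical
  have h1 := σ.next_one α
  have h2 := σ.tsum_ext α fun tr _ => A.cost tr
  have h3 : ∑ tr : A.toPA.Tr, σ.prob α.2 tr * ∑ v, tr.dist v * A.cost tr = A.stepCost σ α := by
    refine Finset.sum_congr rfl fun tr _ => ?_
    rw [← Finset.sum_mul, ← tsum_fintype (L := .unconditional S), PMF.tsum_coe, one_mul, mul_comm]
  rw [h3] at h2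
  rw [← h1, ← h2, Scheduler.next, Scheduler.next, ← ENNReal.tsum_mul_left, ← ENNReal.tsum_mul_left,
    ← ENNReal.tsum_add]
  refine tsum_congr fun q => ?_
  simp only [FinFrags.extend, weightedCost, mul_one]
  rw [mul_add, mul_comm, mul_left_comm (σ.step _ _ _), Finset.mul_sum]
  congr 2
  refine Finset.sum_congr rfl fun tr htr => ?_
  rw [← (Finset.mem_filter.1 htr).2, mul_left_comm, σ.step_mul_hat, mul_comm]

/-- Accounting identity for the expected weighted cost up to a given level. -/
theorem CPA.level_weightedCost [Fintype S] (A : CPA S Act) (σ : Scheduler A.toPA) (s : S)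
    (d : ℕ → ℝ≥0∞) (n : ℕ) :
    ∑ j ∈ Finset.range n, σ.level s j (fun α => A.weightedCost σ d α.2 * σ.halt α.2)
        + σ.level s n (fun α => A.weightedCost σ d α.2)
      = ∑ j ∈ Finset.range n, d j * σ.level s j (A.stepCost σ) := by
  induction n with
  | zero => simp [Scheduler.level_zero, weightedCost]
  | succ n ih =>
    rw [Finset.sum_range_succ, Finset.sum_range_succ, ← ih, Scheduler.level_succ, add_assoc,
      ← Scheduler.level_const_mul, add_assoc, ← Scheduler.level_add, ← Scheduler.level_add]
    congr 1
    refine σ.level_congr s n fun α hα => ?_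
    rw [next_weightedCost, ← add_assoc, ← mul_add, σ.halt_add_sum_prob, mul_one, hα]

theorem CPA.weakCost_eq (A : CPA S Act) (σ : Scheduler A.toPA) (s : S) :
    A.weakCost σ s = ∑' n, σ.level s n (fun α => A.fragCost σ α.2 * σ.halt α.2) := by
  rw [Scheduler.tsum_level]
  exact tsum_congr fun α => mul_left_comm _ _ _

/-- With all weights equal to one, drop from the accounting identity the cost already spent by
executions still running. Termination is not needed for this direction. -/
theorem CPA.weakCost_le [Fintype S] (A : CPA S Act) (σ : Scheduler A.toPA) (s : S) :
    A.weakCost σ s ≤ ∑' n, σ.level s n (A.stepCost σ) := by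
  rw [weakCost_eq, ENNReal.tsum_eq_iSup_nat]
  refine iSup_le fun n => ?_
  have := A.level_weightedCost σ s (fun _ => 1) n
  simp only [weightedCost_one, one_mul] at this
  exact (le_self_add.trans this.le).trans (ENNReal.sum_le_tsum _)

/-- The normalised contributions sum to at most one, so the sum of all transition costs crudely
bounds the cost of a single step. -/
theorem CPA.weightedCost_le (A : CPA S Act) (σ : Scheduler A.toPA) (d : ℕ → ℝ≥0∞) {u : S}
    (α : FinFrag A.toPA u) :
    A.weightedCost σ d α ≤ (∑ tr, (A.cost tr : ℝ≥0∞)) * ∑ j ∈ Finset.range α.len, d j := by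
  classical
  induction α with
  | nil => exact zero_le
  | snoc α b v _ ih =>
    simp only [weightedCost, FinFrag.len, Finset.sum_range_succ, mul_add]
    refine add_le_add ih ?_
    rw [mul_comm]
    gcongr
    calc ∑ tr : A.toPA.Tr with tr.act = b, (A.cost tr : ℝ≥0∞) * σ.hat α v b tr
        ≤ ∑ tr : A.toPA.Tr with tr.act = b, (∑ tr', (A.cost tr' : ℝ≥0∞)) * σ.hat α v b tr := by
          gcongr with tr
          exact Finset.single_le_sum (f := fun tr => (A.cost tr : ℝ≥0∞)) (fun _ _ => zero_le)
            (Finset.mem_univ tr)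
      _ ≤ ∑ tr', (A.cost tr' : ℝ≥0∞) := by
          rw [← Finset.mul_sum]
          refine mul_le_of_le_one_right' ?_
          unfold Scheduler.hat
          split_ifs
          · simp only [div_eq_mul_inv, ← Finset.sum_mul]
            exact ENNReal.div_self_le_one
          · simp

/-- For an almost surely terminating scheduler the expected total cost of all steps is at most the
expected cost of the complete execution. -/
theorem CPA.le_weakCost [Fintype S] (A : CPA S Act) (σ : Scheduler A.toPA) (s : S)
    (h : ∑' α : FinFrags A.toPA, σ.fragProb s α.2 = 1) :
    ∑' n, σ.level s n (A.stepCost σ) ≤ A.weakCost σ s := by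
  rw [ENNReal.tsum_eq_iSup_nat]
  refine iSup_le fun N => ?_
  -- Charging only the first `N` steps keeps the cost of running executions below `B`, so the
  -- remainder in the accounting identity is at most `B` times the surviving mass, which vanishes in
  -- the limit.
  let d : ℕ → ℝ≥0∞ := fun j => if j < N then 1 else 0
  let B : ℝ≥0∞ := (∑ tr, (A.cost tr : ℝ≥0∞)) * N
  have hB : B ≠ ⊤ := ENNReal.mul_ne_top (by simp) (ENNReal.natCast_ne_top N)
  have hd : ∀ n, ∑ j ∈ Finset.range n, d j ≤ N := by
    intro n
    simp only [d, ← Finset.sum_filter]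
    rw [Finset.sum_const, nsmul_one, Nat.cast_le]
    calc _ ≤ (Finset.range N).card := Finset.card_le_card fun j hj => by simp_all
      _ = N := Finset.card_range N
  have hlim : Tendsto (fun n => A.weakCost σ s + B * σ.level s n fun _ => 1) atTop
      (𝓝 (A.weakCost σ s + B * 0)) :=
    tendsto_const_nhds.add (ENNReal.Tendsto.const_mul (σ.tendsto_level_one s h) (Or.inr hB))
  rw [mul_zero, add_zero] at hlim
  refine ge_of_tendsto hlim (eventually_atTop.2 ⟨N, fun n hn => ?_⟩)
  calc ∑ j ∈ Finset.range N, σ.level s j (A.stepCost σ)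
      = ∑ j ∈ Finset.range N, d j * σ.level s j (A.stepCost σ) :=
        Finset.sum_congr rfl fun j hj => by simp [d, Finset.mem_range.1 hj]
    _ ≤ ∑ j ∈ Finset.range n, d j * σ.level s j (A.stepCost σ) :=
        Finset.sum_le_sum_of_subset (Finset.range_mono hn)
    _ = _ := (A.level_weightedCost σ s d n).symm
    _ ≤ A.weakCost σ s + B * σ.level s n fun _ => 1 := by
        rw [← Scheduler.level_const_mul, weakCost_eq]
        refine add_le_add ((Finset.sum_le_sum fun j _ => ?_).trans (ENNReal.sum_le_tsum _)) ?_
        · refine σ.level_mono s j fun α => ?_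
          rw [← weightedCost_one]
          gcongr
          refine A.weightedCost_mono σ (fun j => ?_) _
          simp only [d]
          split_ifs <;> simp
        · refine σ.level_mono s n fun α => (A.weightedCost_le σ d α.2).trans ?_
          rw [mul_one]
          exact mul_le_mul' le_rfl (hd _)

end Levels

/-! ### From flows to schedulers -/

section LayerScheduler

variable {S Act : Type*}

open scoped Classical in
/-- Total flow leaving the state `v` in layer `m`, if `G` flows through the transitions and `O`
leaves the network. -/
noncomputable def outflow {A : PA S Act} (G : Bool → A.Tr → ℝ≥0∞) (O : Bool → S → ℝ≥0∞)
    (m : Bool) (v : S) : ℝ≥0∞ :=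
  (∑ tr : A.Tr, if tr.src = v then G m tr else 0) + O m v

open scoped Classical in
/-- The scheduler that chooses transitions in proportion to a given flow. -/
noncomputable def layerScheduler (A : PA S Act) (a : Act) (G : Bool → A.Tr → ℝ≥0∞)
    (O : Bool → S → ℝ≥0∞) : Scheduler A where
  prob {u} α tr := (α.layer a).elim 0 fun m =>
    if tr.src = u then G m tr / outflow G O m u else 0
  sum_le_one {u} α := by
    cases α.layer a with
    | none => simp
    | some m =>
      simp only [Option.elim_some]
      calc (∑ tr : A.Tr, if tr.src = u then G m tr / outflow G O m u else 0)
          = (∑ tr : A.Tr, if tr.src = u then G m tr else 0) / outflow G O m u := by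
            simp only [div_eq_mul_inv, Finset.sum_mul, ite_mul, zero_mul]
        _ ≤ outflow G O m u / outflow G O m u := by
            gcongr
            exact le_self_add
        _ ≤ 1 := ENNReal.div_self_le_one
  src_eq {u} α tr h := by
    cases hm : α.layer a with
    | none => simp [hm] at h
    | some m =>
      simp only [hm, Option.elim_some] at h
      exact (ite_ne_right_iff.1 h).1

open scoped Classical in
/-- Indicator function of the fragments that end in the state `v` of layer `m`. -/
noncomputable def ind (A : PA S Act) (a : Act) (m : Bool) (v : S) (α : FinFrags A) : ℝ≥0∞ :=
  if α.2.layer a = some m ∧ α.1 = v then 1 else 0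

theorem ind_eq_one {A : PA S Act} {a : Act} {m : Bool} {α : FinFrags A}
    (h : α.2.layer a = some m) : ind A a m α.1 α = 1 := by
  simp [ind, h]

theorem ind_le_one {A : PA S Act} {a : Act} (m : Bool) (v : S) (α : FinFrags A) :
    ind A a m v α ≤ 1 := by
  unfold ind
  split_ifs <;> simp

open scoped Classical in
/-- Indicator function of the fragments whose trace cannot be completed to that of `a`. -/
noncomputable def deadInd (A : PA S Act) (a : Act) (α : FinFrags A) : ℝ≥0∞ :=
  if α.2.layer a = none then 1 else 0

theorem one_eq_sum_ind [Fintype S] {A : PA S Act} (a : Act) (α : FinFrags A) :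
    1 = deadInd A a α + ∑ m : Bool, ∑ v, ind A a m v α := by
  classical
  cases h : α.2.layer a with
  | none => simp [deadInd, ind, h]
  | some m => cases m <;> simp [deadInd, ind, h, -Finset.sum_boole]

variable {A : PA S Act} {a : Act} {G : Bool → A.Tr → ℝ≥0∞} {O : Bool → S → ℝ≥0∞}

/-- A combination of indicators with constant coefficients: expectations under this scheduler reduce
to visit counts. -/
theorem layerScheduler_prob (α : FinFrags A) (tr : A.Tr) :
    (layerScheduler A a G O).prob α.2 tr
      = ∑ m : Bool, ind A a m tr.src α * (G m tr / outflow G O m tr.src) := by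
  classical
  simp only [layerScheduler, ind]
  cases h : α.2.layer a with
  | none => simp
  | some m =>
    by_cases hs : tr.src = α.1
    · cases m <;> simp [hs]
    · simp [hs, Ne.symm hs]

theorem layerScheduler_halt {u : S} (α : FinFrag A u) {m : Bool} (hm : α.layer a = some m)
    (h0 : outflow G O m u ≠ 0) (htop : outflow G O m u ≠ ⊤) :
    (layerScheduler A a G O).halt α = O m u / outflow G O m u := by
  classical
  have h1 : ∑ tr : A.Tr, (layerScheduler A a G O).prob α tr
      = (∑ tr : A.Tr, if tr.src = u then G m tr else 0) / outflow G O m u := by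
    simp only [layerScheduler, hm, Option.elim_some, div_eq_mul_inv, Finset.sum_mul, ite_mul,
      zero_mul]
  rw [Scheduler.halt, h1]
  refine ENNReal.sub_eq_of_eq_add_rev ?_ ?_
  · refine ENNReal.div_ne_top (ne_top_of_le_ne_top htop le_self_add) h0
  · rw [← ENNReal.add_div]
    exact (ENNReal.div_self h0 htop).symm

theorem IsFinal.unique {m m' : Bool} (h : IsFinal A a m) (h' : IsFinal A a m') : m = m' := by
  have := h.trans h'.symm
  cases m <;> cases m' <;> simp_all

theorem exists_isFinal (A : PA S Act) (a : Act) : ∃ m, IsFinal A a m := by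
  by_cases ha : a ∈ A.hidden
  · exact ⟨false, by simp [IsFinal, ha]⟩
  · exact ⟨true, by simp [IsFinal, ha]⟩

variable [Fintype S]

open scoped Classical in
theorem layerScheduler_level_succ_ind (hG : ∀ m tr, ¬ Admissible A a m tr → G m tr = 0) (s : S)
    (n : ℕ) (m : Bool) (v : S) :
    (layerScheduler A a G O).level s (n + 1) (ind A a m v)
      = ∑ m' : Bool, ∑ tr : A.Tr, (if nextLayer A m' tr = m then
          G m' tr / outflow G O m' tr.src * tr.dist v else 0)
          * (layerScheduler A a G O).level s n (ind A a m' tr.src) := by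
  simp only [← Scheduler.level_const_mul, ← Scheduler.level_sum]
  rw [Scheduler.level_succ]
  refine Scheduler.level_congr _ _ _ fun α _ => ?_
  have h := (layerScheduler A a G O).next_layer a (fun o x => if o = some m ∧ x = v then 1 else 0) α
  refine h.trans ?_
  rw [Finset.sum_comm]
  refine Finset.sum_congr rfl fun tr _ => ?_
  rw [layerScheduler_prob, Finset.sum_mul]
  refine Finset.sum_congr rfl fun m' _ => ?_
  by_cases hadm : Admissible A a m' tr
  · by_cases hl : α.2.layer a = some m'
    · rw [hl, stepLayer_of_admissible hadm]
      by_cases hn : nextLayer A m' tr = m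
      · simp [hn]
        ring
      · simp [hn]
    · simp [ind, hl]
  · simp [hG _ _ hadm]

/-- Only transitions carrying flow are chosen, and these are admissible, so the trace can always
still be completed. -/
theorem layerScheduler_level_dead (hG : ∀ m tr, ¬ Admissible A a m tr → G m tr = 0) (s : S)
    (n : ℕ) : (layerScheduler A a G O).level s n (deadInd A a) = 0 := by
  classical
  cases n with
  | zero => simp [Scheduler.level_zero, deadInd, FinFrag.layer]
  | succ n =>
    rw [Scheduler.level_succ]
    refine (Scheduler.level_congr _ _ _ (ψ := fun _ => 0 * 1) fun α _ => ?_).trans ?_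
    · refine ((layerScheduler A a G O).next_layer a (fun o x => if o = none then 1 else 0) α).trans ?_
      rw [zero_mul]
      refine Finset.sum_eq_zero fun tr _ => ?_
      rw [layerScheduler_prob, Finset.sum_mul]
      refine Finset.sum_eq_zero fun m' _ => ?_
      by_cases hadm : Admissible A a m' tr
      · by_cases hl : α.2.layer a = some m'
        · rw [hl, stepLayer_of_admissible hadm]
          simp
        · simp [ind, hl]
      · simp [hG _ _ hadm]
    · rw [Scheduler.level_const_mul, zero_mul]

open scoped Classical in
/-- The expected number of visits to a state of a layer is bounded by the flow through it. -/
theorem layerScheduler_visits_le (hG : ∀ m tr, ¬ Admissible A a m tr → G m tr = 0) {s : S}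
    (hbal : ∀ m v, (if m = false ∧ v = s then 1 else 0)
      + ∑ m' : Bool, ∑ tr : A.Tr, (if nextLayer A m' tr = m then G m' tr * tr.dist v else 0)
      = outflow G O m v) (m : Bool) (v : S) :
    ∑' n, (layerScheduler A a G O).level s n (ind A a m v) ≤ outflow G O m v := by
  rw [ENNReal.tsum_eq_iSup_nat]
  refine iSup_le fun n => ?_
  induction n generalizing m v with
  | zero => simp
  | succ n ih =>
    -- The visit at time zero matches the source term of the balance equation. Later visits come
    -- through transitions, each used at most as often as its flow by the induction hypothesis.
    rw [Finset.sum_range_succ', ← hbal, add_comm]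
    refine add_le_add ?_ ?_
    · rw [Scheduler.level_zero]
      refine le_of_eq ?_
      simp [ind, FinFrag.layer, eq_comm]
    · simp only [layerScheduler_level_succ_ind hG]
      rw [Finset.sum_comm]
      refine Finset.sum_le_sum fun m' _ => ?_
      rw [Finset.sum_comm]
      refine Finset.sum_le_sum fun tr _ => ?_
      rw [← Finset.mul_sum]
      split_ifs
      · calc G m' tr / outflow G O m' tr.src * tr.dist v * _
            ≤ G m' tr / outflow G O m' tr.src * tr.dist v * outflow G O m' tr.src := by
              gcongr
              exact ih _ _
          _ = (outflow G O m' tr.src * (G m' tr / outflow G O m' tr.src)) * tr.dist v := by ring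
          _ ≤ G m' tr * tr.dist v := by
              gcongr
              exact ENNReal.mul_div_le
      · simp

/-- The expected length of an execution is bounded through the finitely many visit counts, each at
most a finite flow. -/
theorem layerScheduler_sum_level_one_lt_top
    (hG : ∀ m tr, ¬ Admissible A a m tr → G m tr = 0) {s : S}
    (hvis : ∀ m v, ∑' n, (layerScheduler A a G O).level s n (ind A a m v) ≤ outflow G O m v)
    (htop : ∀ m v, outflow G O m v ≠ ⊤) :
    ∑' n, (layerScheduler A a G O).level s n (fun _ => 1) ≠ ⊤ := by
  have h : ∀ n, (layerScheduler A a G O).level s n (fun _ => 1)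
      = ∑ m : Bool, ∑ v, (layerScheduler A a G O).level s n (ind A a m v) := by
    intro n
    rw [(layerScheduler A a G O).level_congr s n fun α _ => one_eq_sum_ind a α,
      Scheduler.level_add, layerScheduler_level_dead hG, zero_add, Scheduler.level_sum]
    refine Finset.sum_congr rfl fun m _ => ?_
    rw [Scheduler.level_sum]
  simp only [h]
  rw [Summable.tsum_finsetSum fun _ _ => ENNReal.summable]
  refine (ENNReal.sum_lt_top.2 fun m _ => ?_).ne
  rw [Summable.tsum_finsetSum fun _ _ => ENNReal.summable]
  exact ENNReal.sum_lt_top.2 fun v _ => (hvis m v).trans_lt (htop m v).lt_top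

/-- The surviving masses are summable, hence tend to zero, and the halted mass tends to one. -/
theorem Scheduler.terminates_of_sum_level_ne_top (σ : Scheduler A) {s : S}
    (h : ∑' n, σ.level s n (fun _ => 1) ≠ ⊤) : ∑' α : FinFrags A, σ.fragProb s α.2 = 1 := by
  have h1 := (ENNReal.summable (f := fun n => σ.level s n fun α => σ.halt α.2)).hasSum.tendsto_sum_nat
  have h2 := h1.add (ENNReal.tendsto_atTop_zero_of_tsum_ne_top h)
  simp only [σ.sum_level_halt_add_level_one s, add_zero, tsum_level] at h2
  exact tendsto_nhds_unique h2 tendsto_const_nhds |>.trans rfl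

/-- The probability of a cone is at most the expected number of visits to its last state and layer.
So the fragments where the scheduler is defined by `0 / 0` or by the default `0` are never reached.
-/
theorem layerScheduler_coneProb_eq_zero (hG : ∀ m tr, ¬ Admissible A a m tr → G m tr = 0) {s : S}
    (hvis : ∀ m v, ∑' n, (layerScheduler A a G O).level s n (ind A a m v) ≤ outflow G O m v)
    {u : S} (α : FinFrag A u) (h : ∀ m, α.layer a = some m → outflow G O m u = 0) :
    (layerScheduler A a G O).coneProb s α = 0 := by
  have key : ∀ φ : FinFrags A → ℝ≥0∞, φ ⟨u, α⟩ = 1 →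
      (layerScheduler A a G O).coneProb s α ≤ ∑' n, (layerScheduler A a G O).level s n φ := by
    intro φ hφ
    rw [Scheduler.tsum_level]
    refine le_trans ?_ (ENNReal.le_tsum ⟨u, α⟩)
    rw [hφ, mul_one]
  cases hl : α.layer a with
  | none =>
    have := key (deadInd A a) (by simp [deadInd, hl])
    simpa [layerScheduler_level_dead hG] using this
  | some m =>
    have h1 := (key (ind A a m u) (ind_eq_one (α := ⟨u, α⟩) hl)).trans (hvis m u)
    rw [h m hl] at h1
    exact le_antisymm h1 zero_le

theorem eq_of_sum_eq_of_le {ι : Type*} [Fintype ι] {x y : ι → ℝ≥0∞} (h : ∀ i, x i ≤ y i)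
    (hsum : ∑ i, x i = ∑ i, y i) (htop : ∑ i, x i ≠ ⊤) (i : ι) : x i = y i := by
  classical
  refine le_antisymm (h i) ?_
  have hx := Finset.add_sum_erase Finset.univ x (Finset.mem_univ i)
  have hy := Finset.add_sum_erase Finset.univ y (Finset.mem_univ i)
  have hne : ∑ j ∈ Finset.univ.erase i, x j ≠ ⊤ := ne_top_of_le_ne_top htop (hx ▸ le_add_self)
  refine (ENNReal.add_le_add_iff_right hne).1 ?_
  calc y i + ∑ j ∈ Finset.univ.erase i, x j ≤ y i + ∑ j ∈ Finset.univ.erase i, y j := by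
        gcongr with j
        exact h j
    _ = _ := by rw [hy, hx, hsum]

/-- A scheduler that follows a flow induces a weak combined transition into the distribution that
leaves the network. -/
theorem layerScheduler_induces (hG : ∀ m tr, ¬ Admissible A a m tr → G m tr = 0) {s : S}
    (hvis : ∀ m v, ∑' n, (layerScheduler A a G O).level s n (ind A a m v) ≤ outflow G O m v)
    (htop : ∀ m v, outflow G O m v ≠ ⊤) (hO : ∀ m v, ¬ IsFinal A a m → O m v = 0)
    {m : Bool} (hm : IsFinal A a m) (ν : PMF S) (hν : ∀ v, O m v = ν v) :
    (layerScheduler A a G O).Induces s a ν := by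
  classical
  set σ := layerScheduler A a G O
  have hterm : ∑' α : FinFrags A, σ.fragProb s α.2 = 1 :=
    σ.terminates_of_sum_level_ne_top (layerScheduler_sum_level_one_lt_top hG hvis htop)
  have hpos : ∀ {u : S} (α : FinFrag A u), σ.fragProb s α ≠ 0 →
      α.layer a = some m ∧ σ.fragProb s α = σ.coneProb s α * (ν u / outflow G O m u) := by
    intro u α h
    have h1 : σ.coneProb s α ≠ 0 := left_ne_zero_of_mul h
    have h2 : σ.halt α ≠ 0 := right_ne_zero_of_mul h
    obtain ⟨m', hl, h3⟩ : ∃ m', α.layer a = some m' ∧ outflow G O m' u ≠ 0 := by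
      by_contra! h3
      exact h1 (layerScheduler_coneProb_eq_zero hG hvis α h3)
    have h4 : σ.halt α = _ := layerScheduler_halt α hl h3 (htop m' u)
    obtain rfl : m' = m := by
      by_contra h5
      refine h2 (h4.trans ?_)
      rw [hO _ _ fun h6 => h5 (h6.unique hm), ENNReal.zero_div]
    refine ⟨hl, ?_⟩
    rw [Scheduler.fragProb, h4, hν]
  refine ⟨hterm, fun α h => α.trace_eq_iff.2 ⟨m, hm, (hpos α h.ne').1⟩, ?_⟩
  -- The bound on visits gives only `≤` at each state; since both sides have total mass one,
  -- equality follows.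
  refine eq_of_sum_eq_of_le (fun u => ?_) ?_ ?_
  · have h1 : ∀ α : FinFrag A u, σ.fragProb s α
        ≤ σ.coneProb s α * ind A a m u ⟨u, α⟩ * (ν u / outflow G O m u) := by
      intro α
      by_cases h : σ.fragProb s α = 0
      · rw [h]
        exact zero_le
      · rw [ind_eq_one (α := ⟨u, α⟩) (hpos α h).1, mul_one]
        exact (hpos α h).2.le
    calc ∑' α : FinFrag A u, σ.fragProb s α
        ≤ ∑' α : FinFrag A u, σ.coneProb s α * ind A a m u ⟨u, α⟩ * (ν u / outflow G O m u) :=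
          ENNReal.tsum_le_tsum h1
      _ ≤ ∑' α : FinFrags A, σ.coneProb s α.2 * ind A a m u α * (ν u / outflow G O m u) :=
          ENNReal.tsum_comp_le_tsum_of_injective (f := Sigma.mk u) sigma_mk_injective
            (fun α : FinFrags A => σ.coneProb s α.2 * ind A a m u α * (ν u / outflow G O m u))
      _ ≤ outflow G O m u * (ν u / outflow G O m u) := by
          rw [ENNReal.tsum_mul_right, ← Scheduler.tsum_level]
          gcongr
          exact hvis m u
      _ ≤ ν u := ENNReal.mul_div_le
  · rw [← tsum_fintype (L := .unconditional S), ← tsum_fintype (L := .unconditional S),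
      PMF.tsum_coe, ← hterm, ENNReal.tsum_sigma']
  · rw [← tsum_fintype (L := .unconditional S), ← ENNReal.tsum_sigma' fun α : FinFrags A =>
      σ.fragProb s α.2, hterm]
    exact ENNReal.one_ne_top

/-- A transition is used with the fixed proportion `G m tr / outflow` at each visit to its source,
hence at most `G m tr` times in expectation. -/
theorem layerScheduler_weakCost_le (A : CPA S Act) {a : Act} {G : Bool → A.toPA.Tr → ℝ≥0∞}
    {O : Bool → S → ℝ≥0∞} {s : S}
    (hvis : ∀ m v, ∑' n, (layerScheduler A.toPA a G O).level s n (ind A.toPA a m v)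
      ≤ outflow G O m v) :
    A.weakCost (layerScheduler A.toPA a G O) s ≤ ∑ m : Bool, ∑ tr : A.toPA.Tr, A.cost tr * G m tr := by
  refine (A.weakCost_le _ s).trans ?_
  have h : ∀ n, (layerScheduler A.toPA a G O).level s n (A.stepCost (layerScheduler A.toPA a G O))
      = ∑ m : Bool, ∑ tr : A.toPA.Tr, A.cost tr * (G m tr / outflow G O m tr.src)
          * (layerScheduler A.toPA a G O).level s n (ind A.toPA a m tr.src) := by
    intro n
    simp only [← Scheduler.level_const_mul, ← Scheduler.level_sum]
    refine Scheduler.level_congr _ _ _ fun α _ => ?_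
    rw [Finset.sum_comm]
    refine Finset.sum_congr rfl fun (tr : A.toPA.Tr) _ => ?_
    rw [layerScheduler_prob, Finset.mul_sum]
    exact Finset.sum_congr rfl fun m _ => by ring
  simp only [h]
  rw [Summable.tsum_finsetSum fun _ _ => ENNReal.summable]
  refine Finset.sum_le_sum fun m _ => ?_
  rw [Summable.tsum_finsetSum fun _ _ => ENNReal.summable]
  refine Finset.sum_le_sum fun (tr : A.toPA.Tr) _ => ?_
  rw [ENNReal.tsum_mul_left, mul_assoc]
  gcongr
  calc G m tr / outflow G O m tr.src * _
      ≤ G m tr / outflow G O m tr.src * outflow G O m tr.src := by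
        gcongr
        exact hvis _ _
    _ = outflow G O m tr.src * (G m tr / outflow G O m tr.src) := mul_comm _ _
    _ ≤ G m tr := ENNReal.mul_div_le

/-- Every flow is realised by a scheduler of at most the same cost. -/
theorem LayerFlow.exists_scheduler {A : CPA S Act} {R : S → S → Prop} {t : S} {a : Act} {μ : PMF S}
    {g : Bool → A.toPA.Tr → ℝ} {w : S → S → ℝ} (hg : LayerFlow A.toPA R t a μ g w) :
    ∃ (σ : Scheduler A.toPA) (ν : PMF S), σ.Induces t a ν ∧ Lift R μ ν ∧
      A.weakCost σ t ≤ ENNReal.ofReal (A.layerCost g) := by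
  classical
  have hW : ∀ u, ∑ v, ENNReal.ofReal (w u v) = μ u := fun u => by
    rw [← ENNReal.ofReal_sum_of_nonneg fun v _ => hg.w_nonneg u v, hg.sink,
      ENNReal.ofReal_toReal (PMF.apply_ne_top _ _)]
  have hν : ∑ v, ∑ u, ENNReal.ofReal (w u v) = 1 := by
    rw [Finset.sum_comm]
    simp only [hW]
    rw [← tsum_fintype (L := .unconditional S), PMF.tsum_coe]
  let ν : PMF S := PMF.ofFintype (fun v => ∑ u, ENNReal.ofReal (w u v)) hν
  let G : Bool → A.toPA.Tr → ℝ≥0∞ := fun m tr => ENNReal.ofReal (g m tr)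
  let O : Bool → S → ℝ≥0∞ := fun m v => if IsFinal A.toPA a m then ν v else 0
  have hG : ∀ m tr, ¬ Admissible A.toPA a m tr → G m tr = 0 := fun m tr h => by
    simp [G, hg.g_zero m tr h]
  have hbal : ∀ m v, (if m = false ∧ v = t then 1 else 0)
      + ∑ m' : Bool, ∑ tr : A.toPA.Tr, (if nextLayer A.toPA m' tr = m then
          G m' tr * tr.dist v else 0) = outflow G O m v := by
    intro m v
    have h := congrArg ENNReal.ofReal (hg.balance m v)
    have hn : ∀ m' (tr : A.toPA.Tr), 0 ≤
        if nextLayer A.toPA m' tr = m then g m' tr * (tr.dist v).toReal else 0 := fun m' tr => by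
      split_ifs
      · exact mul_nonneg (hg.g_nonneg _ _) ENNReal.toReal_nonneg
      · rfl
    have hn' : ∀ tr : A.toPA.Tr, 0 ≤ if tr.src = v then g m tr else 0 := fun tr => by
      split_ifs
      · exact hg.g_nonneg _ _
      · rfl
    have hn'' : 0 ≤ ∑ u, w u v := Finset.sum_nonneg fun u _ => hg.w_nonneg u v
    rw [ENNReal.ofReal_add (by split_ifs <;> norm_num)
      (Finset.sum_nonneg fun _ _ => Finset.sum_nonneg fun _ _ => hn _ _),
      ENNReal.ofReal_add (Finset.sum_nonneg fun _ _ => hn' _) (by split_ifs <;> simp [hn'']),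
      ENNReal.ofReal_sum_of_nonneg fun _ _ => Finset.sum_nonneg fun _ _ => hn _ _,
      ENNReal.ofReal_sum_of_nonneg fun _ _ => hn' _] at h
    simp only [ENNReal.ofReal_sum_of_nonneg fun _ _ => hn _ _, apply_ite ENNReal.ofReal,
      ENNReal.ofReal_one, ENNReal.ofReal_zero, ENNReal.ofReal_mul (hg.g_nonneg _ _),
      ENNReal.ofReal_toReal (PMF.apply_ne_top _ _),
      ENNReal.ofReal_sum_of_nonneg fun u _ => hg.w_nonneg u v] at h
    exact h
  have htop : ∀ m v, outflow G O m v ≠ ⊤ := by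
    intro m v
    refine ENNReal.add_ne_top.2 ⟨?_, ?_⟩
    · refine (ENNReal.sum_lt_top.2 fun tr _ => ?_).ne
      split_ifs <;> simp [G]
    · simp only [O]
      split_ifs
      · exact PMF.apply_ne_top _ _
      · simp
  have hvis := layerScheduler_visits_le hG hbal
  obtain ⟨m, hm⟩ := exists_isFinal A.toPA a
  refine ⟨layerScheduler A.toPA a G O, ν, layerScheduler_induces hG hvis htop
    (fun m v h => if_neg h) hm ν (fun v => if_pos hm),
    ⟨fun u v => ENNReal.ofReal (w u v), fun u v => ?_, fun u v h => ?_, fun u => ?_, fun v => ?_⟩, ?_⟩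
  · exact ((Finset.single_le_sum (f := fun v => ENNReal.ofReal (w u v)) (fun _ _ => zero_le)
      (Finset.mem_univ v)).trans (hW u).le).trans (PMF.coe_le_one _ _)
  · by_contra h'
    simp [hg.w_zero u v h'] at h
  · rw [tsum_fintype, hW]
  · rw [tsum_fintype]
    rfl
  · refine (layerScheduler_weakCost_le A hvis).trans (le_of_eq ?_)
    have hn : ∀ m tr, 0 ≤ (A.cost tr : ℝ) * g m tr := fun m tr =>
      mul_nonneg (A.cost tr).coe_nonneg (hg.g_nonneg _ _)
    rw [CPA.layerCost, ENNReal.ofReal_sum_of_nonneg fun m _ => Finset.sum_nonneg fun _ _ => hn _ _]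
    simp only [ENNReal.ofReal_sum_of_nonneg fun _ _ => hn _ _,
      ENNReal.ofReal_mul (NNReal.coe_nonneg _), ENNReal.ofReal_coe_nnreal, G]

end LayerScheduler

/-! ### Limits of approximate flows -/

section Closure

variable {S Act : Type*} [Fintype S]

theorem ite_linearMap_apply {E : Type*} [AddCommGroup E] [Module ℝ E] (p : Prop) [Decidable p]
    (L : E →ₗ[ℝ] ℝ) (z : E) : (if p then L else 0) z = if p then L z else 0 := by
  split_ifs <;> rfl

open scoped Classical in
/-- Nonnegative approximate flows whose costs converge yield a flow with the limit cost. -/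
theorem exists_layerFlow_of_tendsto (A : PA S Act) (R : S → S → Prop) (t : S) (a : Act) (μ : PMF S)
    (c : A.Tr → ℝ) (C : ℝ) (g : ℕ → Bool → A.Tr → ℝ) (w : ℕ → S → S → ℝ)
    (hg : ∀ n m tr, 0 ≤ g n m tr) (hw : ∀ n u v, 0 ≤ w n u v)
    (hg0 : ∀ n m tr, ¬ Admissible A a m tr → g n m tr = 0) (hw0 : ∀ n u v, ¬ R u v → w n u v = 0)
    (hbal : ∀ m v, Tendsto (fun n => (∑ tr : A.Tr, if tr.src = v then g n m tr else 0)
        + (if IsFinal A a m then ∑ u, w n u v else 0)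
        - ∑ m' : Bool, ∑ tr : A.Tr,
          if nextLayer A m' tr = m then g n m' tr * (tr.dist v).toReal else 0) atTop
        (𝓝 (if m = false ∧ v = t then 1 else 0)))
    (hsink : ∀ u, Tendsto (fun n => ∑ v, w n u v) atTop (𝓝 (μ u).toReal))
    (hcost : Tendsto (fun n => ∑ m : Bool, ∑ tr : A.Tr, c tr * g n m tr) atTop (𝓝 C)) :
    ∃ g w, LayerFlow A R t a μ g w ∧ ∑ m : Bool, ∑ tr : A.Tr, c tr * g m tr = C := by
  let ι := (Bool × A.Tr) ⊕ (S × S)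
  let P : Bool → A.Tr → (ι → ℝ) →ₗ[ℝ] ℝ := fun m tr => LinearMap.proj (Sum.inl (m, tr))
  let Q : S → S → (ι → ℝ) →ₗ[ℝ] ℝ := fun u v => LinearMap.proj (Sum.inr (u, v))
  -- All constraints on `g` and `w` become linear equations in one nonnegative vector, with the cost
  -- as one further equation. No convergence or boundedness of the vectors is needed.
  let ℓ : ((Bool × A.Tr) ⊕ (S × S)) ⊕ (Bool × S) ⊕ S ⊕ Unit → (ι → ℝ) →ₗ[ℝ] ℝ
    | .inl (.inl (m, tr)) => if Admissible A a m tr then 0 else P m tr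
    | .inl (.inr (u, v)) => if R u v then 0 else Q u v
    | .inr (.inl (m, v)) => (∑ tr : A.Tr, if tr.src = v then P m tr else 0)
        + (if IsFinal A a m then ∑ u, Q u v else 0)
        - ∑ m' : Bool, ∑ tr : A.Tr,
          if nextLayer A m' tr = m then (tr.dist v).toReal • P m' tr else 0
    | .inr (.inr (.inl u)) => ∑ v, Q u v
    | .inr (.inr (.inr ())) => ∑ m : Bool, ∑ tr : A.Tr, c tr • P m tr
  let y : ((Bool × A.Tr) ⊕ (S × S)) ⊕ (Bool × S) ⊕ S ⊕ Unit → ℝ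
    | .inl _ => 0
    | .inr (.inl (m, v)) => if m = false ∧ v = t then 1 else 0
    | .inr (.inr (.inl u)) => (μ u).toReal
    | .inr (.inr (.inr ())) => C
  let z : ℕ → ι → ℝ := fun n => Sum.elim (fun p => g n p.1 p.2) fun p => w n p.1 p.2
  have hP : ∀ n m tr, P m tr (z n) = g n m tr := fun _ _ _ => rfl
  have hQ : ∀ n u v, Q u v (z n) = w n u v := fun _ _ _ => rfl
  obtain ⟨x, hx0, hx⟩ := exists_nonneg_eq_of_tendsto ℓ y z
    (by rintro n (⟨m, tr⟩ | ⟨u, v⟩); exacts [hg n m tr, hw n u v]) (by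
      rintro ((⟨m, tr⟩ | ⟨u, v⟩) | ⟨m, v⟩ | u | ⟨⟩)
      · refine tendsto_const_nhds.congr fun n => ?_
        by_cases h : Admissible A a m tr
        · simp [ℓ, y, h]
        · simp [ℓ, y, h, hP, hg0 n m tr h]
      · refine tendsto_const_nhds.congr fun n => ?_
        by_cases h : R u v
        · simp [ℓ, y, h]
        · simp [ℓ, y, h, hQ, hw0 n u v h]
      · refine (hbal m v).congr fun n => ?_
        simp only [ℓ, LinearMap.sub_apply, LinearMap.add_apply, LinearMap.sum_apply,
          ite_linearMap_apply, LinearMap.smul_apply, hP, hQ, smul_eq_mul, mul_comm]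
      · refine (hsink u).congr fun n => ?_
        simp only [ℓ, LinearMap.sum_apply, hQ]
      · refine hcost.congr fun n => ?_
        simp only [ℓ, LinearMap.sum_apply, LinearMap.smul_apply, hP, smul_eq_mul])
  refine ⟨fun m tr => P m tr x, fun u v => Q u v x, ⟨fun m tr => hx0 _, fun u v => hx0 _,
    fun m tr h => ?_, fun u v h => ?_, fun m v => ?_, fun u => ?_⟩, ?_⟩
  · simpa [ℓ, y, h] using hx (.inl (.inl (m, tr)))
  · simpa [ℓ, y, h] using hx (.inl (.inr (u, v)))
  · have := hx (.inr (.inl (m, v)))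
    simp only [ℓ, y, LinearMap.sub_apply, LinearMap.add_apply, LinearMap.sum_apply,
      ite_linearMap_apply, LinearMap.smul_apply, smul_eq_mul] at this
    rw [← this]
    simp only [mul_comm]
    ring
  · simpa only [ℓ, y, LinearMap.sum_apply] using hx (.inr (.inr (.inl u)))
  · simpa only [ℓ, y, LinearMap.sum_apply, LinearMap.smul_apply, smul_eq_mul]
      using hx (.inr (.inr (.inr ())))

end Closure

/-! ### From schedulers to truncated counts -/

section SchedulerFlow

variable {S Act : Type*}

namespace Scheduler

variable {A : PA S Act} (σ : Scheduler A)

/-- Probability of the next transition being `tr`, taken from layer `m`. -/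
noncomputable def taken (a : Act) (m : Bool) (tr : A.Tr) (α : FinFrags A) : ℝ≥0∞ :=
  ind A a m tr.src α * σ.prob α.2 tr

theorem prob_le_one {u : S} (α : FinFrag A u) (tr : A.Tr) : σ.prob α tr ≤ 1 :=
  (Finset.single_le_sum (fun _ _ => zero_le) (Finset.mem_univ tr)).trans (σ.sum_le_one α)

open scoped Classical in
theorem ind_mul_prob (a : Act) (m : Bool) (v : S) (tr : A.Tr) (α : FinFrags A) :
    ind A a m v α * σ.prob α.2 tr = if tr.src = v then σ.taken a m tr α else 0 := by
  split_ifs with h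
  · rw [taken, h]
  · by_cases h1 : σ.prob α.2 tr = 0
    · rw [h1, mul_zero]
    · have h2 : α.1 ≠ v := fun h' => h (h' ▸ σ.src_eq _ _ h1)
      simp [ind, h2]

open scoped Classical in
theorem ind_eq_halt_add (a : Act) (m : Bool) (v : S) (α : FinFrags A) :
    ind A a m v α = ind A a m v α * σ.halt α.2
      + ∑ tr : A.Tr, if tr.src = v then σ.taken a m tr α else 0 := by
  simp only [← ind_mul_prob]
  rw [← Finset.mul_sum, ← mul_add, σ.halt_add_sum_prob, mul_one]

variable {σ} {s : S} {a : Act} {ν : PMF S}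

theorem Induces.layer_eq (h : σ.Induces s a ν) {m : Bool} (hm : IsFinal A a m) {u : S}
    (α : FinFrag A u) (hα : σ.fragProb s α ≠ 0) : α.layer a = some m := by
  obtain ⟨m', hm', h'⟩ := α.trace_eq_iff.1 (h.trace_eq α (pos_iff_ne_zero.2 hα))
  rw [h', hm'.unique hm]

open scoped Classical in
-- Stopping happens only with the right trace, that is, in the final layer.
theorem Induces.tsum_level_ind_mul_halt (h : σ.Induces s a ν) (m : Bool) (v : S) :
    ∑' j, σ.level s j (fun α => ind A a m v α * σ.halt α.2) = if IsFinal A a m then ν v else 0 := by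
  rw [tsum_level]
  have h1 : ∀ α : FinFrags A, σ.coneProb s α.2 * (ind A a m v α * σ.halt α.2)
      = ind A a m v α * σ.fragProb s α.2 := fun α => mul_left_comm _ _ _
  simp only [h1]
  split_ifs with hm
  · rw [ENNReal.tsum_sigma', tsum_eq_single v fun u hu => by simp [ind, hu], ← h.target]
    refine tsum_congr fun α => ?_
    by_cases h0 : σ.fragProb s α = 0
    · simp [h0]
    · rw [ind_eq_one (α := ⟨v, α⟩) (h.layer_eq hm _ h0), one_mul]
  · refine ENNReal.tsum_eq_zero.2 fun α => ?_
    by_cases h0 : σ.fragProb s α.2 = 0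
    · simp [h0]
    · obtain ⟨m', hm'⟩ := exists_isFinal A a
      have : m' ≠ m := fun h' => hm (h' ▸ hm')
      simp [ind, h.layer_eq hm' _ h0, this]

variable (σ) [Fintype S]

theorem sum_dist (tr : A.Tr) : ∑ v, tr.dist v = 1 := by
  rw [← tsum_fintype (L := .unconditional S), PMF.tsum_coe]

open scoped Classical in
theorem next_deadInd (α : FinFrags A) :
    σ.next (deadInd A a) α = ∑ tr : A.Tr, σ.prob α.2 tr *
      if stepLayer A a (α.2.layer a) tr.act = none then 1 else 0 := by
  refine (σ.next_layer a (fun o x => if o = none then 1 else 0) α).trans ?_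
  simp only [← Finset.sum_mul, sum_dist, one_mul]

variable {σ}

/-- Executions with a spoilt trace neither recover nor stop, so their mass is nondecreasing in `n`.
It is also bounded by the surviving mass, which tends to zero. -/
theorem Induces.level_dead (h : σ.Induces s a ν) (n : ℕ) : σ.level s n (deadInd A a) = 0 := by
  classical
  obtain ⟨m, hm⟩ := exists_isFinal A a
  have hmono : Monotone fun n => σ.level s n (deadInd A a) := by
    refine monotone_nat_of_le_succ fun n => ?_
    have h0 : σ.level s n (fun α => deadInd A a α * σ.halt α.2) = 0 := by
      refine ENNReal.tsum_eq_zero.2 fun α => ?_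
      split_ifs
      · by_cases h1 : σ.fragProb s α.2 = 0
        · rw [mul_left_comm]
          exact mul_eq_zero_of_right _ h1
        · simp [deadInd, h.layer_eq hm _ h1]
      · rfl
    calc σ.level s n (deadInd A a)
        = σ.level s n (fun α => deadInd A a α * σ.halt α.2
            + deadInd A a α * ∑ tr, σ.prob α.2 tr) := by
          simp only [← mul_add, halt_add_sum_prob, mul_one]
      _ = σ.level s n (fun α => deadInd A a α * ∑ tr, σ.prob α.2 tr) := by
          rw [level_add, h0, zero_add]
      _ ≤ σ.level s (n + 1) (deadInd A a) := by
          rw [level_succ]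
          refine σ.level_mono s n fun α => ?_
          rw [next_deadInd]
          by_cases hl : α.2.layer a = none
          · simp [deadInd, hl, stepLayer]
          · simp [deadInd, hl]
  refine le_antisymm (ge_of_tendsto (σ.tendsto_level_one s h.terminates)
    (eventually_atTop.2 ⟨n, fun k hk => (hmono hk).trans (σ.level_mono s k fun α => ?_)⟩)) zero_le
  unfold deadInd
  split_ifs <;> simp

/-- An inadmissible transition would spoil the trace at the next level, where there is no dead mass.
-/
theorem Induces.level_taken_eq_zero (h : σ.Induces s a ν) {m : Bool} {tr : A.Tr}
    (hadm : ¬ Admissible A a m tr) (n : ℕ) : σ.level s n (σ.taken a m tr) = 0 := by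
  classical
  refine le_antisymm ?_ zero_le
  rw [← h.level_dead (n + 1), level_succ]
  refine σ.level_mono s n fun α => ?_
  rw [next_deadInd]
  by_cases hl : α.2.layer a = some m
  · refine le_trans ?_ (Finset.single_le_sum (fun _ _ => zero_le) (Finset.mem_univ tr))
    have hm : m = true → a ∉ A.hidden := by
      rintro rfl
      exact ((α.2.layer_spec a).2.1 hl).1
    rw [hl, stepLayer_of_not_admissible hm hadm, if_pos rfl, taken, mul_comm]
    gcongr
    exact ind_le_one _ _ _
  · simp [taken, ind, hl]

open scoped Classical in
theorem next_ind (a : Act) (m : Bool) (v : S) (α : FinFrags A) :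
    σ.next (ind A a m v) α = ∑ m' : Bool, ∑ tr : A.Tr,
      (if Admissible A a m' tr ∧ nextLayer A m' tr = m then tr.dist v else 0)
        * σ.taken a m' tr α := by
  refine (σ.next_layer a (fun o x => if o = some m ∧ x = v then 1 else 0) α).trans ?_
  rw [Finset.sum_comm]
  refine Finset.sum_congr rfl fun tr _ => ?_
  by_cases hp : σ.prob α.2 tr = 0
  · simp [taken, hp]
  have hs : tr.src = α.1 := σ.src_eq _ _ hp
  cases hl : α.2.layer a with
  | none => simp [taken, ind, hl, stepLayer]
  | some m' =>
    have hm : m' = true → a ∉ A.hidden := by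
      rintro rfl
      exact ((α.2.layer_spec a).2.1 hl).1
    rw [Finset.sum_eq_single m' (fun m'' _ hm'' => by simp [taken, ind, hl, hm''.symm]) (by simp)]
    rw [taken, hs, ind_eq_one hl, one_mul, mul_comm]
    congr 1
    by_cases hadm : Admissible A a m' tr
    · rw [stepLayer_of_admissible hadm]
      by_cases hn : nextLayer A m' tr = m <;> simp [hn, hadm]
    · rw [stepLayer_of_not_admissible hm hadm]
      simp [hadm]

/-- Expected number of times that `tr` is taken from layer `m` within the first `n` steps. -/
noncomputable def count (σ : Scheduler A) (s : S) (a : Act) (n : ℕ) (m : Bool) (tr : A.Tr) :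
    ℝ≥0∞ :=
  ∑ j ∈ Finset.range n, σ.level s j (σ.taken a m tr)

theorem count_ne_top (n : ℕ) (m : Bool) (tr : A.Tr) : σ.count s a n m tr ≠ ⊤ := by
  refine (ENNReal.sum_lt_top.2 fun j _ => ?_).ne
  refine ((σ.level_mono s j fun α => ?_).trans (σ.level_one_le s j)).trans_lt ENNReal.one_lt_top
  exact mul_le_one' (ind_le_one _ _ _) (σ.prob_le_one _ _)

open scoped Classical in
-- Visits at times `0, …, n` are counted twice: by how the state was entered, and by how it was
-- left. The visits at time `n` have not been left yet and form the error term.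
theorem Induces.balance (h : σ.Induces s a ν) (n : ℕ) (m : Bool) (v : S) :
    (if m = false ∧ v = s then 1 else 0) + ∑ m' : Bool, ∑ tr : A.Tr,
        (if nextLayer A m' tr = m then σ.count s a n m' tr * tr.dist v else 0)
      = (∑ tr : A.Tr, if tr.src = v then σ.count s a n m tr else 0)
        + ∑ j ∈ Finset.range n, σ.level s j (fun α => ind A a m v α * σ.halt α.2)
        + σ.level s n (ind A a m v) := by
  have h1 : ∑ j ∈ Finset.range (n + 1), σ.level s j (ind A a m v)
      = ∑ j ∈ Finset.range n, σ.level s j (fun α => ind A a m v α * σ.halt α.2)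
        + (∑ tr : A.Tr, if tr.src = v then σ.count s a n m tr else 0)
        + σ.level s n (ind A a m v) := by
    rw [Finset.sum_range_succ]
    congr 1
    have : ∀ j, σ.level s j (ind A a m v) = σ.level s j (fun α => ind A a m v α * σ.halt α.2)
        + ∑ tr : A.Tr, if tr.src = v then σ.level s j (σ.taken a m tr) else 0 := by
      intro j
      rw [σ.level_congr s j fun α _ => σ.ind_eq_halt_add a m v α, level_add, level_sum]
      congr 1
      refine Finset.sum_congr rfl fun tr _ => ?_
      split_ifs
      · rfl
      · simp [level]
    simp only [this]
    rw [Finset.sum_add_distrib, Finset.sum_comm]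
    congr 1
    refine Finset.sum_congr rfl fun tr _ => ?_
    split_ifs
    · rfl
    · simp
  refine Eq.trans ?_ (h1.trans (by ac_rfl))
  rw [Finset.sum_range_succ', add_comm]
  congr 1
  · have h2 : ∀ j, σ.level s (j + 1) (ind A a m v) = ∑ m' : Bool, ∑ tr : A.Tr,
        (if nextLayer A m' tr = m then tr.dist v else 0) * σ.level s j (σ.taken a m' tr) := by
      intro j
      rw [level_succ, σ.level_congr s j fun α _ => next_ind a m v α]
      simp only [level_sum, level_const_mul]
      refine Finset.sum_congr rfl fun m' _ => Finset.sum_congr rfl fun tr _ => ?_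
      by_cases hadm : Admissible A a m' tr
      · simp [hadm]
      · rw [h.level_taken_eq_zero hadm, mul_zero, mul_zero]
    simp only [h2]
    refine Eq.trans ?_ Finset.sum_comm
    refine Finset.sum_congr rfl fun m' _ => ?_
    refine Eq.trans ?_ Finset.sum_comm
    refine Finset.sum_congr rfl fun tr _ => ?_
    rw [← Finset.mul_sum, ite_mul, zero_mul, mul_comm]
    rfl
  · rw [level_zero]
    simp [ind, FinFrag.layer, eq_comm]

end Scheduler

end SchedulerFlow

/-! ### Comparing the two minima -/

section Main

variable {S Act : Type*} [Fintype S]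

/-- A scheduler gives rise to a flow; if a cost bound is known for the truncations, the flow
respects it. -/
theorem Scheduler.Induces.exists_layerFlow {A : PA S Act} {R : S → S → Prop} {t : S} {a : Act}
    {μ ν : PMF S} {σ : Scheduler A} (h : σ.Induces t a ν) (hR : Lift R μ ν) (c : A.Tr → ℝ≥0)
    {K : ℝ≥0} (hK : ∀ n, ∑ m : Bool, ∑ tr : A.Tr, (c tr : ℝ≥0∞) * σ.count t a n m tr ≤ K) :
    ∃ g w, LayerFlow A R t a μ g w ∧ ∑ m : Bool, ∑ tr : A.Tr, (c tr : ℝ) * g m tr ≤ K := by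
  classical
  obtain ⟨w, hw1, hwR, hwμ, hwν⟩ := hR
  have hwtop : ∀ u v, w u v ≠ ⊤ := fun u v => ne_top_of_le_ne_top ENNReal.one_ne_top (hw1 u v)
  simp only [tsum_fintype] at hwμ hwν
  let g : ℕ → Bool → A.Tr → ℝ := fun n m tr => (σ.count t a n m tr).toReal
  have hcost : ∀ n, ∑ m : Bool, ∑ tr : A.Tr, (c tr : ℝ) * g n m tr
      = (∑ m : Bool, ∑ tr : A.Tr, (c tr : ℝ≥0∞) * σ.count t a n m tr).toReal := by
    intro n
    have hne : ∀ m (tr : A.Tr), (c tr : ℝ≥0∞) * σ.count t a n m tr ≠ ⊤ := fun m tr =>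
      ENNReal.mul_ne_top ENNReal.coe_ne_top (Scheduler.count_ne_top _ _ _)
    rw [ENNReal.toReal_sum fun m _ => (ENNReal.sum_lt_top.2 fun tr _ => (hne m tr).lt_top).ne]
    simp only [ENNReal.toReal_sum fun tr _ => hne _ tr, ENNReal.toReal_mul, ENNReal.coe_toReal, g]
  have hbound : ∀ n, ∑ m : Bool, ∑ tr : A.Tr, (c tr : ℝ) * g n m tr ≤ K := fun n => by
    rw [hcost]
    exact ENNReal.toReal_le_coe_of_le_coe (hK n)
  have hmono : Monotone fun n => ∑ m : Bool, ∑ tr : A.Tr, (c tr : ℝ) * g n m tr := by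
    intro n n' hn
    refine Finset.sum_le_sum fun m _ => Finset.sum_le_sum fun tr _ => ?_
    refine mul_le_mul_of_nonneg_left (ENNReal.toReal_mono (Scheduler.count_ne_top _ _ _) ?_)
      (c tr).coe_nonneg
    exact Finset.sum_le_sum_of_subset (Finset.range_mono hn)
  -- Only the total cost is known to converge; counts of transitions of cost zero may diverge.
  have hconv := tendsto_atTop_ciSup hmono ⟨K, by rintro _ ⟨n, rfl⟩; exact hbound n⟩
  refine (exists_layerFlow_of_tendsto A R t a μ (fun tr => c tr) _ g
    (fun _ u v => (w u v).toReal) (fun _ _ _ => ENNReal.toReal_nonneg)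
    (fun _ _ _ => ENNReal.toReal_nonneg) (fun n m tr hadm => ?_) (fun _ u v huv => ?_)
    (fun m v => ?_) (fun u => ?_) hconv).imp
    fun _ => Exists.imp fun _ h => ⟨h.1, h.2.le.trans (ciSup_le hbound)⟩
  · simp [g, Scheduler.count, h.level_taken_eq_zero hadm]
  · rw [le_antisymm (not_lt.1 fun h' => huv (hwR u v h')) zero_le, ENNReal.toReal_zero]
  · have hb := h.balance
    let H : ℕ → ℝ≥0∞ := fun n =>
      ∑ j ∈ Finset.range n, σ.level t j (fun α => ind A a m v α * σ.halt α.2)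
    have hHlim : Tendsto H atTop (𝓝 (if IsFinal A a m then ν v else 0)) := by
      rw [← h.tsum_level_ind_mul_halt]
      exact ENNReal.summable.hasSum.tendsto_sum_nat
    have hHle : ∀ n, H n ≤ if IsFinal A a m then ν v else 0 := fun n => by
      rw [← h.tsum_level_ind_mul_halt]
      exact ENNReal.sum_le_tsum _
    have hν : (if IsFinal A a m then ν v else 0) ≠ ⊤ := by
      split_ifs
      · exact PMF.apply_ne_top _ _
      · simp
    have hHtop : ∀ n, H n ≠ ⊤ := fun n => ne_top_of_le_ne_top hν (hHle n)
    have hLle : ∀ n, σ.level t n (ind A a m v) ≤ σ.level t n (fun _ => 1) := fun n =>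
      σ.level_mono t n fun α => ind_le_one _ _ _
    have hLlim : Tendsto (fun n => σ.level t n (ind A a m v)) atTop (𝓝 0) :=
      tendsto_of_tendsto_of_tendsto_of_le_of_le tendsto_const_nhds
        (σ.tendsto_level_one t h.terminates) (fun _ => zero_le) hLle
    have hLtop : ∀ n, σ.level t n (ind A a m v) ≠ ⊤ := fun n =>
      ne_top_of_le_ne_top ENNReal.one_ne_top ((hLle n).trans (σ.level_one_le t n))
    have hfin : (if IsFinal A a m then ∑ u, (w u v).toReal else 0)
        = (if IsFinal A a m then ν v else 0).toReal := by
      split_ifs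
      · rw [← hwν, ENNReal.toReal_sum fun u _ => hwtop u v]
      · rfl
    -- The counts are truncated but `w` is not, so the defect of the balance at `n` consists of the
    -- final mass not yet stopped, minus the mass still at `v`. Both tend to zero.
    have hlim := (((ENNReal.tendsto_toReal hν).comp hHlim).add
      ((ENNReal.tendsto_toReal ENNReal.zero_ne_top).comp hLlim)).const_sub
      ((if m = false ∧ v = t then 1 else 0) + (if IsFinal A a m then ν v else 0).toReal)
    rw [ENNReal.toReal_zero, add_zero, add_sub_cancel_right] at hlim
    refine hlim.congr fun n => ?_
    have hreal := congrArg ENNReal.toReal (hb n m v)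
    have h1 : ∀ m' (tr : A.Tr), (if nextLayer A m' tr = m then
        σ.count t a n m' tr * tr.dist v else 0) ≠ ⊤ := fun m' tr => by
      split_ifs
      · exact ENNReal.mul_ne_top (Scheduler.count_ne_top _ _ _) (PMF.apply_ne_top _ _)
      · simp
    have h2 : ∀ tr : A.Tr, (if tr.src = v then σ.count t a n m tr else 0) ≠ ⊤ := fun tr => by
      split_ifs
      · exact Scheduler.count_ne_top _ _ _
      · simp
    have h1' : ∀ m', ∑ tr : A.Tr, (if nextLayer A m' tr = m then
        σ.count t a n m' tr * tr.dist v else 0) ≠ ⊤ := fun m' =>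
      (ENNReal.sum_lt_top.2 fun tr _ => (h1 m' tr).lt_top).ne
    have h2' := (ENNReal.sum_lt_top.2 fun tr (_ : tr ∈ Finset.univ) => (h2 tr).lt_top).ne
    rw [ENNReal.toReal_add (by split_ifs <;> simp)
      (ENNReal.sum_lt_top.2 fun m' _ => (h1' m').lt_top).ne,
      ENNReal.toReal_add (ENNReal.add_ne_top.2 ⟨h2', hHtop n⟩) (hLtop n),
      ENNReal.toReal_add h2' (hHtop n), ENNReal.toReal_sum fun m' _ => h1' m',
      ENNReal.toReal_sum fun tr _ => h2 tr] at hreal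
    simp only [ENNReal.toReal_sum fun tr _ => h1 _ tr, apply_ite ENNReal.toReal,
      ENNReal.toReal_one, ENNReal.toReal_zero, ENNReal.toReal_mul] at hreal
    rw [hfin]
    simp only [Function.comp, H, g]
    linarith
  · refine tendsto_const_nhds.congr fun _ => ?_
    rw [← hwμ, ENNReal.toReal_sum fun v _ => hwtop u v]

/-- At every level the cost of the transitions taken from either layer is part of the expected step
cost, and `CPA.le_weakCost` bounds the sum of those. -/
theorem Scheduler.Induces.sum_cost_count_le {A : CPA S Act} {t : S} {a : Act} {ν : PMF S}
    {σ : Scheduler A.toPA} (h : σ.Induces t a ν) (n : ℕ) :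
    ∑ m : Bool, ∑ tr : A.toPA.Tr, (A.cost tr : ℝ≥0∞) * σ.count t a n m tr ≤ A.weakCost σ t := by
  classical
  refine le_trans ?_ ((ENNReal.sum_le_tsum (Finset.range n)).trans (A.le_weakCost σ t h.terminates))
  simp only [Scheduler.count, Finset.mul_sum, ← Scheduler.level_const_mul]
  rw [Finset.sum_congr rfl fun m _ => Finset.sum_comm, Finset.sum_comm]
  refine Finset.sum_le_sum fun j _ => ?_
  simp only [← Scheduler.level_sum]
  refine σ.level_mono t j fun α => ?_
  rw [Finset.sum_comm, CPA.stepCost]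
  refine Finset.sum_le_sum fun tr _ => ?_
  rw [← Finset.mul_sum]
  gcongr
  simp only [Scheduler.taken, ← Finset.sum_mul]
  refine mul_le_of_le_one_left' ?_
  refine le_trans ?_ ((one_eq_sum_ind a α).ge.trans' le_add_self)
  exact Finset.sum_le_sum fun m _ => Finset.single_le_sum (f := fun v => ind A.toPA a m v α)
    (fun _ _ => zero_le) (Finset.mem_univ tr.src)

theorem mem_lpValues_iff {A : CPA S Act} {R : S → S → Prop} {t : S} {a : Act} {μ : PMF S} {r : ℝ} :
    r ∈ A.lpValues R t a μ ↔ ∃ g w, LayerFlow A.toPA R t a μ g w ∧ A.layerCost g = r := by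
  constructor
  · rintro ⟨f, hf, rfl⟩
    exact hf.exists_layerFlow
  · rintro ⟨g, w, hg, rfl⟩
    exact hg.exists_feasible

theorem LayerFlow.layerCost_nonneg {A : CPA S Act} {R : S → S → Prop} {t : S} {a : Act}
    {μ : PMF S} {g : Bool → A.toPA.Tr → ℝ} {w : S → S → ℝ} (hg : LayerFlow A.toPA R t a μ g w) :
    0 ≤ A.layerCost g :=
  Finset.sum_nonneg fun m _ => Finset.sum_nonneg fun tr _ =>
    mul_nonneg (A.cost tr).coe_nonneg (hg.g_nonneg m tr)

/-- A feasible min-cost linear program has an optimal solution. -/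
theorem exists_isLeast_lpValues {A : CPA S Act} {R : S → S → Prop} {t : S} {a : Act} {μ : PMF S}
    (h : (A.lpValues R t a μ).Nonempty) : ∃ C, IsLeast (A.lpValues R t a μ) C := by
  classical
  have hbdd : BddBelow (A.lpValues R t a μ) := ⟨0, fun r hr => by
    obtain ⟨g, w, hg, rfl⟩ := mem_lpValues_iff.1 hr
    exact hg.layerCost_nonneg⟩
  refine ⟨sInf (A.lpValues R t a μ), ?_, fun r hr => csInf_le hbdd hr⟩
  obtain ⟨r, -, hr, hmem⟩ := exists_seq_tendsto_sInf h hbdd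
  choose g w hg hcost using fun n => mem_lpValues_iff.1 (hmem n)
  -- A minimising sequence may be unbounded along cycles of cost zero, so a solution comes from
  -- closedness rather than compactness.
  obtain ⟨g', w', hg', hC⟩ := exists_layerFlow_of_tendsto A.toPA R t a μ (fun tr => A.cost tr)
    (sInf (A.lpValues R t a μ)) g w (fun n => (hg n).g_nonneg) (fun n => (hg n).w_nonneg)
    (fun n => (hg n).g_zero) (fun n => (hg n).w_zero)
    (fun m v => tendsto_const_nhds.congr fun n => by
      rw [← (hg n).balance m v, add_sub_cancel_right])
    (fun u => tendsto_const_nhds.congr fun n => ((hg n).sink u).symm)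
    (hr.congr fun n => (hcost n).symm)
  exact mem_lpValues_iff.2 ⟨g', w', hg', hC⟩

end Main

end CostPA

theorem mainTheorem6 {S Act : Type*} [Fintype S] (A : CostPA.CPA S Act)
    (R : S → S → Prop) (a : Act) (μ : PMF S) (t : S)
    (h : ∃ μt : PMF S, CostPA.WeakTransition A.toPA t a μt ∧ CostPA.Lift R μ μt) :
    ∃ C : ℝ≥0,
      IsLeast (A.lpValues R t a μ) (C : ℝ) ∧
      IsLeast (A.costs R t a μ) (C : ℝ≥0∞) := by
  obtain ⟨μt, ⟨σ, hσ⟩, hR⟩ := h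
  have hne : (A.lpValues R t a μ).Nonempty := by
    -- The given scheduler may have infinite cost; with the zero cost function the bound is trivial
    -- and feasibility still follows.
    obtain ⟨g, w, hg, -⟩ := hσ.exists_layerFlow hR (fun _ => 0) (K := 0) (by simp)
    exact ⟨_, CostPA.mem_lpValues_iff.2 ⟨g, w, hg, rfl⟩⟩
  obtain ⟨C, hC⟩ := CostPA.exists_isLeast_lpValues hne
  obtain ⟨g, w, hg, hgC⟩ := CostPA.mem_lpValues_iff.1 hC.1
  lift C to ℝ≥0 using hgC ▸ hg.layerCost_nonneg
  have hlower : (C : ℝ≥0∞) ∈ lowerBounds (A.costs R t a μ) := by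
    rintro _ ⟨σ', ν, hσ', hR', rfl⟩
    by_cases htop : A.weakCost σ' t = ⊤
    · rw [htop]
      exact le_top
    · obtain ⟨g', w', hg', hle⟩ := hσ'.exists_layerFlow hR' A.cost
        (K := (A.weakCost σ' t).toNNReal) fun n => by
          rw [ENNReal.coe_toNNReal htop]
          exact hσ'.sum_cost_count_le n
      have := (hC.2 (CostPA.mem_lpValues_iff.2 ⟨g', w', hg', rfl⟩)).trans hle
      rw [← ENNReal.coe_toNNReal htop]
      exact_mod_cast this
  refine ⟨C, hC, ?_, hlower⟩
  obtain ⟨σ', ν, hσ', hR', hle⟩ := hg.exists_scheduler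
  rw [hgC, ENNReal.ofReal_coe_nnreal] at hle
  -- The scheduler built from an optimal flow costs at most `C`, and the lower bound excludes
  -- anything cheaper.
  exact ⟨σ', ν, hσ', hR', le_antisymm hle (hlower ⟨σ', ν, hσ', hR', rfl⟩)⟩
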